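/- Let $q>2$ be a prime power, let $n\in\{-1,0,1\}$ with $q\equiv n \pmod 3$, and let $g=\gcd(3,q-1)$. Let $V$ be a 3-dimensional vector space over $\mathbb F_{q^3}$. Its $\mathbb F_{q^3}$-subspaces form the plane $\mathrm{PG}(2,q^3)$, and its $\mathbb F_q$-subspaces form $\mathrm{PG}(8,q)$ (field reduction). Let $\phi$ be a collineation of $\mathrm{PG}(2,q^3)$ of order 3 that fixes every point of some $\mathbb F_q$-plane (a subplane consisting of the points whose coordinates with respect to a suitable $\mathbb F_{q^3}$-basis can be chosen in $\mathbb F_q$). Let $\sigma$ be an $\mathbb F_q$-linear automorphism of $V$ with $\sigma^3=1$ that induces $\phi$, that is, $\sigma(P)=\phi(P)$ for every point $P$ of $\mathrm{PG}(2,q^3)$, regarded as an $\mathbb F_q$-subspace of $V$ (a plane of $\mathrm{PG}(8,q)$). A point $P$ of $\mathrm{PG}(2,q^3)$ has Type I if $\phi(P)=P$, and Type II if $P,\phi(P),\phi^2(P)$ are three distinct collinear points. A point $A$ of $\mathrm{PG}(8,q)$ is an $X$-point ($X\in\{\mathrm I,\mathrm{II}\}$) if it lies in a point $P$ of Type $X$;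 it is an $X_{:}$-point if moreover $A,A^\sigma,A^{\sigma^2}$ are distinct and collinear, and an $X_{\therefore}$-point if moreover $A,A^\sigma,A^{\sigma^2}$ form a triangle. "Fixed" means fixed by $\sigma$ as a subspace. A fixed-$X$-line is a fixed line of $\mathrm{PG}(8,q)$ that contains an $X_{:}$-point. A fixed-II-plane is a fixed plane of $\mathrm{PG}(8,q)$ that contains a $\mathrm{II}_{\therefore}$-point; it is a fixed-$\mathrm{II}_1$-plane if it contains exactly one fixed-I-line, and a fixed-$\mathrm{II}_2$-plane if it contains no fixed-I-line. Then every fixed-II-plane is of exactly one of these two types, and: 1. Every fixed-$\mathrm{II}_1$-plane contains exactly $g$ fixed points, $q-n$ $\mathrm I_{:}$-points, $(g-1)(q-n)$ $\mathrm{II}_{:}$-points and $q^2+q+1-g(q-n+1)$ $\mathrm{II}_{\therefore}$-points; and exactly one fixed-I-line and $g-1$ fixed-II-lines. The number of fixed-$\mathrm{II}_1$-planes is $g(q-2+g-n)(q+1)(q^2+q+1)$. 2. Every fixed-$\mathrm{II}_2$-plane contains exactly $g$ fixed points, no $\mathrm I_{:}$-points, $g(q-n)$ $\mathrm{II}_{:}$-points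 and $q^2+q+1-g(q-n+1)$ $\mathrm{II}_{\therefore}$-points; and no fixed-I-line and exactly $g$ fixed-II-lines. The number of fixed-$\mathrm{II}_2$-planes is $(q^3-q)(q^2+q+1)$. -/

import Mathlib

/-! `F` is the field with `q` elements, `K` its cubic extension and `V` a three-dimensional vector
space over `K`.  The projective plane over `K` is the lattice of `K`-subspaces of `V`, and by field
reduction the eight-dimensional projective space over `F` is the lattice of `F`-subspaces of `V`.
Points, lines and planes are the subspaces of vector space dimension 1, 2 and 3. -/

namespace Figueroa

section Plane

variable (F : Type*) {K V : Type*} [Field F] [Field K] [AddCommGroup V] [Module K V] [Module F V]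

/-- `B` is the point set of an `F`-plane (a subplane coordinatised by `F`) of the projective plane
of `V` over `K`: the points with a nonzero vector whose coordinates with respect to a suitable
`K`-basis of `V` all lie in `F`. -/
def IsSubplane (B : Set (Submodule K V)) : Prop :=
  ∃ b : Module.Basis (Fin 3) K V,
    B = {P | ∃ v ∈ Submodule.span F (Set.range b), v ≠ 0 ∧ P = Submodule.span K {v}}

/-- A collineation `φ` (an automorphism of the subspace lattice) of order 3 that fixes every point
of some `F`-plane. -/
def IsPlanarOfOrderThree (φ : Submodule K V ≃o Submodule K V) : Prop :=
  orderOf φ = 3 ∧ ∃ B : Set (Submodule K V), IsSubplane F B ∧ ∀ P ∈ B, φ P = P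

/-- A point of Type I: a fixed point of the collineation `φ`. -/
def IsTypeI (φ : Submodule K V ≃o Submodule K V) (P : Submodule K V) : Prop :=
  Module.finrank K P = 1 ∧ φ P = P

/-- A point of Type II: its orbit under the collineation `φ` of order 3 consists of three
collinear points, that is, the orbit spans a line. -/
def IsTypeII (φ : Submodule K V ≃o Submodule K V) (P : Submodule K V) : Prop :=
  Module.finrank K P = 1 ∧ Module.finrank K ↥(P ⊔ φ P ⊔ φ (φ P)) = 2

end Plane

section Space

variable {F K V : Type*} [Field F] [Field K] [AddCommGroup V] [Module K V] [Module F V]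
  [Algebra F K] [IsScalarTower F K V]

/-- The `F`-linear map `σ` induces the collineation `φ`: for every point `P` of the plane over `K`,
the spread plane of `P` (the vectors of `P`, as an `F`-subspace) is mapped to that of `φ P`. -/
def Induces (σ : V ≃ₗ[F] V) (φ : Submodule K V ≃o Submodule K V) : Prop :=
  ∀ P : Submodule K V, Module.finrank K P = 1 →
    (P.restrictScalars F).map (σ : V →ₗ[F] V) = (φ P).restrictScalars F

/-- The subspace `S` is fixed (as a whole) by `σ`. -/
def IsFixed (σ : V ≃ₗ[F] V) (S : Submodule F V) : Prop :=
  S.map (σ : V →ₗ[F] V) = S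

/-- The span of `A` and of its two images under `σ` and `σ²`. -/
def orbitSpan (σ : V ≃ₗ[F] V) (A : Submodule F V) : Submodule F V :=
  A ⊔ A.map (σ : V →ₗ[F] V) ⊔ (A.map (σ : V →ₗ[F] V)).map (σ : V →ₗ[F] V)

/-- A point of the projective space over `F` that is fixed by `σ`. -/
def IsFixedPoint (σ : V ≃ₗ[F] V) (A : Submodule F V) : Prop :=
  Module.finrank F A = 1 ∧ IsFixed σ A

/-- A I-point: a point in the spread plane of a point of Type I. -/
def IsIPoint (φ : Submodule K V ≃o Submodule K V) (A : Submodule F V) : Prop :=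
  Module.finrank F A = 1 ∧ ∃ P : Submodule K V, IsTypeI φ P ∧ A ≤ P.restrictScalars F

/-- A II-point: a point in the spread plane of a point of Type II. -/
def IsIIPoint (φ : Submodule K V ≃o Submodule K V) (A : Submodule F V) : Prop :=
  Module.finrank F A = 1 ∧ ∃ P : Submodule K V, IsTypeII φ P ∧ A ≤ P.restrictScalars F

/-- A I-point whose orbit under `σ` consists of three collinear points. -/
def IsICollinearPoint (φ : Submodule K V ≃o Submodule K V) (σ : V ≃ₗ[F] V)
    (A : Submodule F V) : Prop :=
  IsIPoint φ A ∧ Module.finrank F ↥(orbitSpan σ A) = 2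

/-- A II-point whose orbit under `σ` consists of three collinear points. -/
def IsIICollinearPoint (φ : Submodule K V ≃o Submodule K V) (σ : V ≃ₗ[F] V)
    (A : Submodule F V) : Prop :=
  IsIIPoint φ A ∧ Module.finrank F ↥(orbitSpan σ A) = 2

/-- A II-point whose orbit under `σ` is a triangle. -/
def IsIITrianglePoint (φ : Submodule K V ≃o Submodule K V) (σ : V ≃ₗ[F] V)
    (A : Submodule F V) : Prop :=
  IsIIPoint φ A ∧ Module.finrank F ↥(orbitSpan σ A) = 3

/-- A fixed-I-line: a fixed line with a I-point whose orbit is three collinear points. -/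
def IsFixedILine (φ : Submodule K V ≃o Submodule K V) (σ : V ≃ₗ[F] V)
    (l : Submodule F V) : Prop :=
  Module.finrank F l = 2 ∧ IsFixed σ l ∧ ∃ A : Submodule F V, A ≤ l ∧ IsICollinearPoint φ σ A

/-- A fixed-II-line: a fixed line with a II-point whose orbit is three collinear points. -/
def IsFixedIILine (φ : Submodule K V ≃o Submodule K V) (σ : V ≃ₗ[F] V)
    (l : Submodule F V) : Prop :=
  Module.finrank F l = 2 ∧ IsFixed σ l ∧ ∃ A : Submodule F V, A ≤ l ∧ IsIICollinearPoint φ σ A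

/-- A fixed-II-plane: a fixed plane with a II-point whose orbit is a triangle. -/
def IsFixedIIPlane (φ : Submodule K V ≃o Submodule K V) (σ : V ≃ₗ[F] V)
    (π : Submodule F V) : Prop :=
  Module.finrank F π = 3 ∧ IsFixed σ π ∧ ∃ A : Submodule F V, A ≤ π ∧ IsIITrianglePoint φ σ A

/-- A fixed-II₁-plane: a fixed-II-plane that contains exactly one fixed-I-line. -/
def IsFixedII₁Plane (φ : Submodule K V ≃o Submodule K V) (σ : V ≃ₗ[F] V)
    (π : Submodule F V) : Prop :=
  IsFixedIIPlane φ σ π ∧ ∃! l : Submodule F V, l ≤ π ∧ IsFixedILine φ σ l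

/-- A fixed-II₂-plane: a fixed-II-plane that contains no fixed-I-line. -/
def IsFixedII₂Plane (φ : Submodule K V ≃o Submodule K V) (σ : V ≃ₗ[F] V)
    (π : Submodule F V) : Prop :=
  IsFixedIIPlane φ σ π ∧ ¬ ∃ l : Submodule F V, l ≤ π ∧ IsFixedILine φ σ l

/-- The number of subspaces of `π` with the property `p`, as an integer. -/
noncomputable def numIn (π : Submodule F V) (p : Submodule F V → Prop) : ℤ :=
  (Set.ncard {S : Submodule F V | S ≤ π ∧ p S} : ℤ)

end Space

end Figueroa

/-! `σ` is semilinear over `K` for a nontrivial field automorphism τ with τ³ = 1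
(`Induces.exists_algEquiv`, `Induces.exists_ne_of_isPlanar`). Galois descent gives a `K`-basis of
fixed vectors (`exists_fixed_basis`), so `σ` applies τ to each coordinate.

A fixed-II-plane is the `F`-span `cyc σ v` of an independent orbit v, σv, σ²v: a copy of F[X]/(X³ −
1) with `σ` acting as X. Its fixed points and its fixed lines are both indexed by the g cube roots
of unity t, through the eigenvector t² + tX + X² and the ideal generated by X − t. The eigenvector
for t' lies on the line for t iff t'² + tt' + t² = 0, which has n + 1 solutions t'
(`ncard_quadraticRoots`). So each fixed line carries n + 1 fixed points and q − n points with
collinear orbit, and T = q² + q + 1 − g(q − n + 1) points of the plane have a triangle as orbit. A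
fixed line is a fixed-I-line or a fixed-II-line according as its `K`-span has dimension 1 or 2. Two
fixed-I-lines would meet and force the whole plane into one `K`-point
(`eigenvaluesOfRk_one_subsingleton`).

To count planes, let L ⊆ K be the `F`-span of the coordinates of v. The matrix of conjugates shows
that the `K`-span of the orbit of v has dimension dim L (`rk_cyc`). Hence v generates a
fixed-II-plane iff L is two-dimensional and not τ-invariant (`isRegularVec_iff_coordSpan`), and that
plane contains a fixed-I-line iff L contains an eigenvector of τ
(`eigenvaluesOfRk_one_nonempty_iff`). By the normal basis theorem K is itself a copy of F[X]/(X³ −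
1), whence g(q − n) such L have an eigenvector and T have none. Each L comes from (q³ − 1)(q³ − q)
vectors v, and each plane has T(q − 1) generators; double counting gives both numbers. -/

namespace Figueroa
open Submodule Module

set_option linter.unusedSectionVars false

/-! ### Cyclic modules over F[X]/(X³ − 1): eigenvectors and invariant subspaces -/

section Cyclic
variable {F E : Type*} [Field F] [AddCommGroup E] [Module F E] (s : E ≃ₗ[F] E)

/-- The span of the orbit of a vector under an automorphism of order dividing three. -/
def cyc (x : E) : Submodule F E := span F {x, s x, s (s x)}

variable {s}

lemma self_mem_cyc (x : E) : x ∈ cyc s x := subset_span (by simp)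

lemma mem_cyc {x y : E} : y ∈ cyc s x ↔ ∃ a b c : F, a • x + b • s x + c • s (s x) = y := by
  rw [cyc, mem_span_triple]

lemma cyc_le {x : E} {J : Submodule F E} (hJ : ∀ y ∈ J, s y ∈ J) (hx : x ∈ J) : cyc s x ≤ J := by
  rw [cyc, span_le]
  rintro _ (rfl | rfl | rfl)
  exacts [hx, hJ _ hx, hJ _ (hJ _ hx)]

lemma orbitSpan_span_singleton (x : E) : orbitSpan s (span F {x}) = cyc s x := by
  simp only [orbitSpan, map_span, Set.image_singleton, cyc, ← span_union]
  congr 1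
  ext y
  simp only [Set.mem_union, Set.mem_insert_iff, Set.mem_singleton_iff, or_assoc]
  rfl

lemma isFixed_iff_mapsTo [FiniteDimensional F E] {J : Submodule F E} :
    IsFixed s J ↔ ∀ y ∈ J, s y ∈ J := by
  constructor
  · intro h y hy
    rw [← h]
    exact mem_map_of_mem hy
  · intro h
    refine eq_of_le_of_finrank_eq ?_ (LinearEquiv.finrank_map_eq s J)
    rintro _ ⟨y, hy, rfl⟩
    exact h y hy

section Order
variable (hs : ∀ x, s (s (s x)) = x)
include hs

lemma apply_mem_cyc {x y : E} (hy : y ∈ cyc s x) : s y ∈ cyc s x := by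
  obtain ⟨a, b, c, rfl⟩ := mem_cyc.1 hy
  exact mem_cyc.2 ⟨c, a, b, by simp only [map_add, map_smul, hs]; abel⟩

lemma cyc_mono {x y : E} (hy : y ∈ cyc s x) : cyc s y ≤ cyc s x :=
  cyc_le (fun _ => apply_mem_cyc hs) hy

end Order

/-- A vector whose orbit is linearly independent. -/
def IsRegularVec (s : E ≃ₗ[F] E) (v : E) : Prop := finrank F (cyc s v) = 3

lemma finrank_cyc_le (x : E) : finrank F (cyc s x) ≤ 3 := by
  classical
  have : cyc s x = span F (({x, s x, s (s x)} : Finset E) : Set E) := by simp [cyc]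
  rw [this]
  exact (finrank_span_finset_le_card _).trans Finset.card_le_three

instance (x : E) : FiniteDimensional F (cyc s x) :=
  FiniteDimensional.span_of_finite F (by simp)

lemma cyc_eq_span_range (x : E) : cyc s x = span F (Set.range ![x, s x, s (s x)]) := by
  rw [cyc]
  congr 1
  ext y
  simp [eq_comm]
  tauto

lemma isRegularVec_iff {v : E} : IsRegularVec s v ↔ LinearIndependent F ![v, s v, s (s v)] := by
  rw [linearIndependent_iff_card_eq_finrank_span, Set.finrank, ← cyc_eq_span_range, IsRegularVec,
    Fintype.card_fin, eq_comm]

lemma IsRegularVec.coord {v : E} (hv : IsRegularVec s v) {a b c : F}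
    (h : a • v + b • s v + c • s (s v) = 0) : a = 0 ∧ b = 0 ∧ c = 0 := by
  have := Fintype.linearIndependent_iff.1 (isRegularVec_iff.1 hv) ![a, b, c]
    (by simpa [Fin.sum_univ_three] using h)
  exact ⟨this 0, this 1, this 2⟩

lemma isRegularVec_of_coord {v : E} (h : ∀ a b c : F, a • v + b • s v + c • s (s v) = 0 →
    a = 0 ∧ b = 0 ∧ c = 0) : IsRegularVec s v := by
  rw [isRegularVec_iff, Fintype.linearIndependent_iff]
  intro f hf i
  have := h (f 0) (f 1) (f 2) (by simpa [Fin.sum_univ_three] using hf)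
  fin_cases i <;> simp [this]

lemma IsRegularVec.ne_zero {v : E} (hv : IsRegularVec s v) : v ≠ 0 := by
  rintro rfl
  have := hv.coord (a := 1) (b := 0) (c := 0) (by simp)
  simp at this

/-- The eigenvector for the eigenvalue `t` in the cyclic subspace of `v`. -/
def eigenvec (s : E ≃ₗ[F] E) (v : E) (t : F) : E := t ^ 2 • v + t • s v + s (s v)

/-- The invariant plane belonging to the eigenvalue `t` in the cyclic subspace of `v`. -/
def eigenplane (s : E ≃ₗ[F] E) (v : E) (t : F) : Submodule F E := cyc s (s v - t • v)

lemma IsRegularVec.eigenvec_ne_zero {v : E} (hv : IsRegularVec s v) (t : F) :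
    eigenvec s v t ≠ 0 := by
  intro h
  have := hv.coord (a := t ^ 2) (b := t) (c := 1) (by simpa [eigenvec] using h)
  simp at this

lemma eigenvec_mem_cyc (v : E) (t : F) : eigenvec s v t ∈ cyc s v :=
  mem_cyc.2 ⟨t ^ 2, t, 1, by simp [eigenvec]⟩

lemma IsRegularVec.coord_eq {v : E} (hv : IsRegularVec s v) {a b c a' b' c' : F}
    (h : a • v + b • s v + c • s (s v) = a' • v + b' • s v + c' • s (s v)) :
    a = a' ∧ b = b' ∧ c = c' := by
  have := hv.coord (a := a - a') (b := b - b') (c := c - c') (by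
    rw [← sub_eq_zero] at h
    rw [← h]
    module)
  simpa [sub_eq_zero] using this

section Order
variable (hs : ∀ x, s (s (s x)) = x)
include hs

/-- (X − t)(X² + tX + t²) = X³ − t³, which acts as zero. -/
lemma apply_eigenvec (v : E) {t : F} (ht : t ^ 3 = 1) :
    s (eigenvec s v t) = t • eigenvec s v t := by
  have : t * t ^ 2 = 1 := by rw [← ht]; ring
  simp only [eigenvec, map_add, map_smul, hs, smul_add, smul_smul, this, one_smul, ← sq]
  abel

lemma eigenvalue_pow_three {x : E} (hx : x ≠ 0) {t : F} (h : s x = t • x) : t ^ 3 = 1 := by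
  have h3 := hs x
  rw [h, map_smul, h, map_smul, map_smul, h, smul_smul, smul_smul] at h3
  have : (t ^ 3 - 1) • x = 0 := by
    rw [sub_smul, one_smul, sub_eq_zero, ← h3]
    rw [h3]
    convert h3 using 2
    ring
  rcases smul_eq_zero.1 this with h | h
  · exact sub_eq_zero.1 h
  · exact absurd h hx

/-- `s` permutes the coordinates cyclically, so (c, a, b) = t(a, b, c) leaves only the choice of c:
eigenspaces are one-dimensional. -/
lemma IsRegularVec.eq_smul_eigenvec {v : E} (hv : IsRegularVec s v) {x : E} {t : F}
    (hx : x ∈ cyc s v) (h : s x = t • x) : ∃ c : F, x = c • eigenvec s v t := by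
  obtain ⟨a, b, c, rfl⟩ := mem_cyc.1 hx
  have := hv.coord_eq (a := c) (b := a) (c := b) (a' := t * a) (b' := t * b) (c' := t * c) (by
    simp only [map_add, map_smul, hs] at h
    rw [show c • v + a • s v + b • s (s v) = a • s v + b • s (s v) + c • v by abel, h]
    module)
  obtain ⟨h1, h2, h3⟩ := this
  refine ⟨c, ?_⟩
  rw [eigenvec, h2, h3]
  module

/-- The polynomial a + bX + cX² is a multiple of X − t modulo X³ − 1 iff it vanishes at the cube
root of unity t. -/
lemma mem_eigenplane {v : E} (hv : IsRegularVec s v) {t : F} (ht : t ^ 3 = 1) {a b c : F} :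
    a • v + b • s v + c • s (s v) ∈ eigenplane s v t ↔ a + t * b + t ^ 2 * c = 0 := by
  rw [eigenplane, mem_cyc]
  constructor
  · rintro ⟨a', b', c', h⟩
    simp only [map_sub, map_smul, hs] at h
    obtain ⟨rfl, rfl, rfl⟩ := hv.coord_eq (a := - t * a' + c') (b := a' - t * b')
      (c := b' - t * c') (a' := a) (b' := b) (c' := c) (by rw [← h]; module)
    linear_combination (-c') * ht
  · intro h
    have : a = - (t * b + t ^ 2 * c) := by linear_combination h
    -- The quotient of a + bX + cX² by X − t is (b + tc) + cX.
    refine ⟨b + t * c, c, 0, ?_⟩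
    simp only [map_sub, map_smul, this]
    module

lemma eigenplane_le (v : E) (t : F) : eigenplane s v t ≤ cyc s v :=
  cyc_mono hs (sub_mem (apply_mem_cyc hs (self_mem_cyc v)) (smul_mem _ _ (self_mem_cyc v)))

lemma IsRegularVec.finrank_eigenplane {v : E} (hv : IsRegularVec s v) {t : F} (ht : t ^ 3 = 1) :
    finrank F (eigenplane s v t) = 2 := by
  have hle : eigenplane s v t = span F (Set.range ![s v - t • v, s (s v) - t • s v]) := by
    apply le_antisymm
    · intro x hx
      obtain ⟨a, b, c, rfl⟩ := mem_cyc.1 (eigenplane_le hs v t hx)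
      have h := (mem_eigenplane hs hv ht).1 hx
      rw [Submodule.mem_span_range_iff_exists_fun]
      refine ⟨![b + t * c, c], ?_⟩
      have : a = - (t * b + t ^ 2 * c) := by linear_combination h
      simp only [Fin.sum_univ_two, Matrix.cons_val_zero, Matrix.cons_val_one, this]
      module
    · rw [span_le]
      rintro _ ⟨i, rfl⟩
      fin_cases i
      · exact self_mem_cyc _
      · have := apply_mem_cyc hs (self_mem_cyc (s := s) (s v - t • v))
        simpa [eigenplane] using this
  rw [hle, finrank_span_eq_card, Fintype.card_fin]
  rw [LinearIndependent.pair_iff]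
  intro a b h
  have := hv.coord (a := - t * a) (b := a - t * b) (c := b) (by rw [← h]; module)
  obtain ⟨-, h2, h3⟩ := this
  subst h3
  simpa using h2

lemma apply_mem_eigenplane {v : E} {t : F} {x : E} (hx : x ∈ eigenplane s v t) :
    s x ∈ eigenplane s v t := apply_mem_cyc hs hx

lemma IsRegularVec.not_mem_eigenplane {v : E} (hv : IsRegularVec s v) {t : F} (ht : t ^ 3 = 1) :
    v ∉ eigenplane s v t := by
  have := mem_eigenplane hs hv ht (a := 1) (b := 0) (c := 0)
  simp at this
  exact this

lemma IsRegularVec.eigenplane_injOn {v : E} (hv : IsRegularVec s v) {t t' : F} (ht : t ^ 3 = 1)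
    (h : eigenplane s v t = eigenplane s v t') : t = t' := by
  by_contra hne
  apply hv.not_mem_eigenplane hs ht
  have h1 : s v - t • v ∈ eigenplane s v t := self_mem_cyc _
  have h2 : s v - t' • v ∈ eigenplane s v t := h ▸ self_mem_cyc _
  have h3 := sub_mem h2 h1
  rw [show s v - t' • v - (s v - t • v) = (t - t') • v by module] at h3
  exact (smul_mem_iff _ (sub_ne_zero.2 hne)).1 h3

/-- An invariant J of dimension 2 misses the generator v and is a complement of its span, so sv ≡ tv
modulo J for some t. Applying t² + ts + s² to sv − tv gives (1 − t³)v in J, hence t³ = 1, and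
dimensions agree. -/
lemma IsRegularVec.eq_eigenplane {v : E} (hv : IsRegularVec s v) {J : Submodule F E}
    (hJv : J ≤ cyc s v) (hJ : ∀ y ∈ J, s y ∈ J) (hJ2 : finrank F J = 2) :
    ∃ t : F, t ^ 3 = 1 ∧ J = eigenplane s v t := by
  have hvJ : v ∉ J := fun h => by
    rw [IsRegularVec] at hv
    have := FiniteDimensional.of_finrank_pos (K := F) (V := J) (by omega)
    have := finrank_mono (cyc_le hJ h)
    omega
  have := FiniteDimensional.of_finrank_pos (K := F) (V := J) (by omega)
  have hsup : J ⊔ span F {v} = cyc s v := by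
    have hle : J ⊔ span F {v} ≤ cyc s v :=
      sup_le hJv (by rw [span_singleton_le_iff_mem]; exact self_mem_cyc v)
    apply eq_of_le_of_finrank_le hle
    have : J < J ⊔ span F {v} := by
      rw [left_lt_sup, span_singleton_le_iff_mem]
      exact hvJ
    have := finrank_lt_finrank_of_lt this
    rw [IsRegularVec] at hv
    omega
  have hsv : s v ∈ J ⊔ span F {v} := hsup ▸ apply_mem_cyc hs (self_mem_cyc v)
  obtain ⟨j, hj, w, hw, hjw⟩ := mem_sup.1 hsv
  obtain ⟨t, rfl⟩ := mem_span_singleton.1 hw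
  have h1 : s v - t • v ∈ J := by rwa [← hjw, add_sub_cancel_right]
  have ht : t ^ 3 = 1 := by
    by_contra ht
    have h2 := hJ _ h1
    have h3 := hJ _ h2
    have h4 := add_mem (add_mem (smul_mem J (t ^ 2) h1) (smul_mem J t h2)) h3
    simp only [map_sub, map_smul, hs] at h4
    rw [show t ^ 2 • (s v - t • v) + t • (s (s v) - t • s v) + (v - t • s (s v)) =
      (1 - t ^ 3) • v by module] at h4
    exact hvJ ((smul_mem_iff _ (sub_ne_zero.2 (Ne.symm ht))).1 h4)
  exact ⟨t, ht, (eq_of_le_of_finrank_eq (cyc_le hJ h1)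
    ((hv.finrank_eigenplane hs ht).trans hJ2.symm)).symm⟩

lemma eigenvec_mem_eigenplane {v : E} (hv : IsRegularVec s v) {t t' : F} (ht : t ^ 3 = 1) :
    eigenvec s v t' ∈ eigenplane s v t ↔ t' ^ 2 + t * t' + t ^ 2 = 0 := by
  have := mem_eigenplane hs hv ht (a := t' ^ 2) (b := t') (c := 1)
  rw [one_smul, mul_one] at this
  exact this

end Order
end Cyclic

/-! ### Counting by fibres; points of a finite projective space -/

section Counting

lemma ncard_eq_ncard_mul_of_fibers {α β : Type*} {S : Set α} (hS : S.Finite) {T : Set β}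
    {f : α → β} (hf : Set.MapsTo f S T) {k : ℕ} (hT : T.Finite)
    (hk : ∀ b ∈ T, {a | a ∈ S ∧ f a = b}.ncard = k) : S.ncard = T.ncard * k := by
  classical
  rw [Set.ncard_eq_toFinset_card S hS, Set.ncard_eq_toFinset_card T hT,
    Finset.card_eq_sum_card_fiberwise (f := f) (t := hT.toFinset) (by simpa using hf),
    Finset.sum_const_nat]
  intro b hb
  rw [← hk b (by simpa using hb), ← Set.ncard_coe_finset]
  congr 1
  ext a
  simp

variable {F E : Type*} [Field F] [AddCommGroup E] [Module F E]

lemma exists_eq_span_of_finrank_eq_one {A : Submodule F E} (hA : finrank F A = 1) :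
    ∃ x : E, x ≠ 0 ∧ A = span F {x} := by
  obtain ⟨⟨x, hx⟩, hx0, h⟩ := finrank_eq_one_iff'.1 hA
  refine ⟨x, by simpa using hx0, le_antisymm (fun y hy => ?_) (by simpa using hx)⟩
  obtain ⟨c, hc⟩ := h ⟨y, hy⟩
  exact mem_span_singleton.2 ⟨c, congrArg Subtype.val hc⟩

lemma ncard_points [Finite F] (S : Submodule F E) {k : ℕ} (hS : finrank F S = k) :
    {A : Submodule F E | A ≤ S ∧ finrank F A = 1}.ncard =
      ∑ i ∈ Finset.range k, Nat.card F ^ i := by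
  rw [← Projectivization.card_of_finrank F S hS,
    Nat.card_congr (Projectivization.equivSubmodule F S)]
  have : {A : Submodule F E | A ≤ S ∧ finrank F A = 1} =
      Submodule.map S.subtype '' {H : Submodule F S | finrank F H = 1} := by
    ext A
    constructor
    · rintro ⟨h1, h2⟩
      refine ⟨A.comap S.subtype, ?_, by simpa using h1⟩
      rw [← h2]
      exact LinearEquiv.finrank_eq (comapSubtypeEquivOfLe h1)
    · rintro ⟨H, h, rfl⟩
      exact ⟨map_subtype_le S H, (finrank_map_subtype_eq S H).trans h⟩
  rw [this, Set.ncard_image_of_injective _ (map_injective_of_injective S.injective_subtype)]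
  rfl

lemma ncard_nonzero_eq [Finite F] [Finite E] (p : Submodule F E → Prop) :
    {x : E | x ≠ 0 ∧ p (span F {x})}.ncard =
      {A : Submodule F E | finrank F A = 1 ∧ p A}.ncard * (Nat.card F - 1) := by
  apply ncard_eq_ncard_mul_of_fibers (Set.toFinite _) (f := fun x => span F {x})
  · rintro x ⟨hx, hp⟩
    exact ⟨finrank_span_singleton hx, hp⟩
  · exact Set.toFinite _
  · rintro A ⟨hA, hp⟩
    obtain ⟨x, hx, rfl⟩ := exists_eq_span_of_finrank_eq_one hA
    have : {a | a ∈ {x : E | x ≠ 0 ∧ p (span F {x})} ∧ span F {a} = span F {x}} =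
        (fun u : Fˣ => u • x) '' Set.univ := by
      ext y
      simp only [Set.mem_ofPred_eq, Set.image_univ, Set.mem_range]
      constructor
      · rintro ⟨⟨hy, -⟩, h⟩
        exact (span_singleton_eq_span_singleton.1 h.symm)
      · rintro ⟨u, rfl⟩
        have : span F {u • x} = span F {x} := (span_singleton_eq_span_singleton.2 ⟨u, rfl⟩).symm
        exact ⟨⟨(smul_ne_zero_iff_ne u).2 hx, this ▸ hp⟩, this⟩
    rw [this, Set.ncard_image_of_injective, Set.ncard_univ, Nat.card_units]
    intro u w h
    ext
    exact smul_left_injective F hx h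

end Counting

/-! ### Cube roots of unity in a finite field -/

section Roots
variable {F : Type*} [Field F] [Finite F]

/-- They form the kernel of cubing on the cyclic group of units, of order q − 1. -/
lemma ncard_cubeRoots : {t : F | t ^ 3 = 1}.ncard = Nat.gcd 3 (Nat.card F - 1) := by
  have h := IsCyclic.card_powMonoidHom_ker (G := Fˣ) 3
  rw [Nat.card_units, Nat.gcd_comm] at h
  rw [← h, ← Nat.card_coe_set_eq]
  symm
  refine Nat.card_congr (Equiv.ofBijective (fun u => ⟨((u : Fˣ) : F), ?_⟩) ⟨?_, ?_⟩)
  · have := u.2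
    rw [MonoidHom.mem_ker, powMonoidHom_apply] at this
    have h3 : ((u : Fˣ) : F) ^ 3 = 1 := by rw [← Units.val_pow_eq_pow_val, this, Units.val_one]
    exact h3
  · intro u w h
    exact Subtype.ext (Units.ext (congrArg Subtype.val h))
  · rintro ⟨t, ht⟩
    have ht' : t * t ^ 2 = 1 := by rw [← pow_succ']; exact ht
    refine ⟨⟨⟨t, t ^ 2, ht', by rw [mul_comm]; exact ht'⟩, ?_⟩, rfl⟩
    rw [MonoidHom.mem_ker, powMonoidHom_apply]
    ext
    exact ht

lemma three_eq_zero_iff : (3 : F) = 0 ↔ 3 ∣ Nat.card F := by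
  constructor
  · intro h
    by_contra hd
    have hc : Nat.Coprime 3 (Nat.card F) := (Nat.Prime.coprime_iff_not_dvd Nat.prime_three).2 hd
    have h1 : Nat.card F • (1 : F) = 0 := card_nsmul_eq_zero'
    have h2 : 3 • (1 : F) = 0 := by simpa using h
    have h3 := Nat.dvd_gcd (addOrderOf_dvd_of_nsmul_eq_zero h2) (addOrderOf_dvd_of_nsmul_eq_zero h1)
    rw [hc, Nat.dvd_one, AddMonoid.addOrderOf_eq_one_iff] at h3
    exact one_ne_zero h3
  · intro h
    have : Fact (Nat.Prime 3) := ⟨Nat.prime_three⟩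
    obtain ⟨x, hx⟩ := exists_prime_addOrderOf_dvd_card' 3 h
    have h0 : x ≠ 0 := by
      rintro rfl
      simp at hx
    have h3 := addOrderOf_nsmul_eq_zero x
    rw [hx, nsmul_eq_mul] at h3
    simpa [h0] using h3

/-- Since x³ − 1 = (x − t)(x² + tx + t²), the roots are the cube roots of unity other than t,
together with t itself exactly when 3t² = 0, that is, in characteristic 3. This is where n enters
all the counts. -/
lemma ncard_quadraticRoots {t : F} (ht : t ^ 3 = 1) {n : ℤ} (hn : n = -1 ∨ n = 0 ∨ n = 1)
    (hqn : (Nat.card F : ℤ) ≡ n [ZMOD 3]) :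
    ({t' : F | t' ^ 2 + t * t' + t ^ 2 = 0}.ncard : ℤ) = n + 1 := by
  have ht0 : t ≠ 0 := by
    rintro rfl
    simp at ht
  have hcard := ncard_cubeRoots (F := F)
  have hpos : 0 < Nat.card F := Nat.card_pos
  have hun : {t' : F | t' ^ 3 = 1} = insert t {t' : F | t' ^ 2 + t * t' + t ^ 2 = 0} := by
    ext x
    simp only [Set.mem_ofPred_eq, Set.mem_insert_iff]
    have : x ^ 3 - 1 = (x - t) * (x ^ 2 + t * x + t ^ 2) := by linear_combination ht
    rw [← sub_eq_zero, this, mul_eq_zero, sub_eq_zero]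
  have hmem : t ∈ {t' : F | t' ^ 2 + t * t' + t ^ 2 = 0} ↔ 3 ∣ Nat.card F := by
    rw [← three_eq_zero_iff, Set.mem_ofPred_eq, show t ^ 2 + t * t + t ^ 2 = 3 * t ^ 2 by ring]
    simp [ht0]
  rw [hun] at hcard
  unfold Int.ModEq at hqn
  by_cases h3 : 3 ∣ Nat.card F
  · rw [Set.insert_eq_of_mem (hmem.2 h3)] at hcard
    have hg : Nat.gcd 3 (Nat.card F - 1) = 1 := by
      refine (Nat.Prime.coprime_iff_not_dvd Nat.prime_three).2 ?_
      omega
    rw [hcard, hg]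
    omega
  · rw [Set.ncard_insert_of_notMem (fun h => h3 (hmem.1 h))] at hcard
    rcases hn with rfl | rfl | rfl
    · have hg : Nat.gcd 3 (Nat.card F - 1) = 1 := by
        refine (Nat.Prime.coprime_iff_not_dvd Nat.prime_three).2 ?_
        omega
      omega
    · omega
    · have hg : Nat.gcd 3 (Nat.card F - 1) = 3 := Nat.gcd_eq_left (by omega)
      omega

end Roots

/-! ### Points of a cyclic plane, sorted by the span of their orbit -/

section CyclicCounting
variable {F E : Type*} [Field F] [AddCommGroup E] [Module F E] {s : E ≃ₗ[F] E}

lemma isFixed_span_iff {x : E} (hx : x ≠ 0) : IsFixed s (span F {x}) ↔ ∃ t : F, s x = t • x := by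
  rw [IsFixed, map_span, Set.image_singleton]
  constructor
  · intro h
    obtain ⟨t, ht⟩ := mem_span_singleton.1 (h ▸ mem_span_singleton_self (R := F) (s x))
    exact ⟨t, ht.symm⟩
  · rintro ⟨t, ht⟩
    have ht0 : t ≠ 0 := by
      rintro rfl
      rw [zero_smul] at ht
      exact hx (s.map_eq_zero_iff.1 ht)
    exact (span_singleton_eq_span_singleton.2 ⟨Units.mk0 t ht0, ht.symm⟩).symm

variable (hs : ∀ x, s (s (s x)) = x)
include hs

lemma fixedPoints_cyc_eq {v : E} (hv : IsRegularVec s v) (J : Submodule F E) (hJ : J ≤ cyc s v) :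
    {A : Submodule F E | A ≤ J ∧ IsFixedPoint s A} =
      (fun t => span F {eigenvec s v t}) '' {t : F | t ^ 3 = 1 ∧ eigenvec s v t ∈ J} := by
  ext A
  constructor
  · rintro ⟨hAJ, hA, hfix⟩
    obtain ⟨x, hx, rfl⟩ := exists_eq_span_of_finrank_eq_one hA
    obtain ⟨t, ht⟩ := (isFixed_span_iff hx).1 hfix
    have ht3 := eigenvalue_pow_three hs hx ht
    have hxJ : x ∈ J := hAJ (mem_span_singleton_self x)
    obtain ⟨c, rfl⟩ := hv.eq_smul_eigenvec hs (hJ hxJ) ht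
    have hc : c ≠ 0 := by
      rintro rfl
      simp at hx
    exact ⟨t, ⟨ht3, (smul_mem_iff _ hc).1 hxJ⟩,
      span_singleton_eq_span_singleton.2 ⟨Units.mk0 c hc, rfl⟩⟩
  · rintro ⟨t, ⟨ht, hmem⟩, rfl⟩
    have h0 := hv.eigenvec_ne_zero t
    exact ⟨(span_singleton_le_iff_mem _ _).2 hmem, finrank_span_singleton h0,
      (isFixed_span_iff h0).2 ⟨t, apply_eigenvec hs v ht⟩⟩

omit hs in
lemma IsRegularVec.span_eigenvec_injective {v : E} (hv : IsRegularVec s v) :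
    Function.Injective (fun t => span F {eigenvec s v t}) := by
  intro t t' h
  obtain ⟨c, hc⟩ := span_singleton_eq_span_singleton.1 h
  rw [Units.smul_def] at hc
  have := hv.coord_eq (a := c * t ^ 2) (b := c * t) (c := c) (a' := t' ^ 2) (b' := t') (c' := 1)
    (by simp only [eigenvec] at hc; rw [one_smul, ← hc]; module)
  obtain ⟨-, h2, h3⟩ := this
  rw [h3, one_mul] at h2
  exact h2

lemma ncard_fixedPoints_cyc {v : E} (hv : IsRegularVec s v) :
    {A : Submodule F E | A ≤ cyc s v ∧ IsFixedPoint s A}.ncard = {t : F | t ^ 3 = 1}.ncard := by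
  rw [fixedPoints_cyc_eq hs hv _ le_rfl, Set.ncard_image_of_injective _ hv.span_eigenvec_injective]
  congr 1
  ext t
  exact ⟨fun h => h.1, fun h => ⟨h, eigenvec_mem_cyc v t⟩⟩

lemma ncard_fixedPoints_eigenplane {v : E} (hv : IsRegularVec s v) {t : F} (ht : t ^ 3 = 1) :
    {A : Submodule F E | A ≤ eigenplane s v t ∧ IsFixedPoint s A}.ncard =
      {t' : F | t' ^ 2 + t * t' + t ^ 2 = 0}.ncard := by
  rw [fixedPoints_cyc_eq hs hv _ (eigenplane_le hs v t),
    Set.ncard_image_of_injective _ hv.span_eigenvec_injective]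
  congr 1
  ext t'
  simp only [Set.mem_ofPred_eq]
  rw [eigenvec_mem_eigenplane hs hv ht]
  constructor
  · exact fun h => h.2
  · intro h
    refine ⟨?_, h⟩
    linear_combination (t' - t) * h + ht

lemma finrank_orbitSpan_eq_one_iff {A : Submodule F E} (hA : finrank F A = 1) :
    finrank F (orbitSpan s A) = 1 ↔ IsFixed s A := by
  obtain ⟨x, hx, rfl⟩ := exists_eq_span_of_finrank_eq_one hA
  rw [orbitSpan_span_singleton]
  have hle : span F {x} ≤ cyc s x := (span_singleton_le_iff_mem _ _).2 (self_mem_cyc x)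
  constructor
  · intro h
    have := eq_of_le_of_finrank_eq hle (hA.trans h.symm)
    rw [isFixed_span_iff hx]
    obtain ⟨t, ht⟩ := mem_span_singleton.1 (this ▸ apply_mem_cyc hs (self_mem_cyc x))
    exact ⟨t, ht.symm⟩
  · intro h
    obtain ⟨t, ht⟩ := (isFixed_span_iff hx).1 h
    rw [← le_antisymm hle (cyc_le (fun y hy => ?_) (mem_span_singleton_self x)), hA]
    obtain ⟨c, rfl⟩ := mem_span_singleton.1 hy
    rw [map_smul, ht]
    exact smul_mem _ _ (smul_mem _ _ (mem_span_singleton_self x))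

omit hs in
lemma finrank_orbitSpan_mem {A : Submodule F E} (hA : finrank F A = 1) :
    1 ≤ finrank F (orbitSpan s A) ∧ finrank F (orbitSpan s A) ≤ 3 := by
  obtain ⟨x, hx, rfl⟩ := exists_eq_span_of_finrank_eq_one hA
  rw [orbitSpan_span_singleton]
  refine ⟨?_, finrank_cyc_le x⟩
  rw [← hA]
  exact finrank_mono ((span_singleton_le_iff_mem _ _).2 (self_mem_cyc x))

omit hs in
lemma orbitSpan_le {A J : Submodule F E} (hA : finrank F A = 1) (hAJ : A ≤ J)
    (hJ : ∀ y ∈ J, s y ∈ J) : orbitSpan s A ≤ J := by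
  obtain ⟨x, hx, rfl⟩ := exists_eq_span_of_finrank_eq_one hA
  rw [orbitSpan_span_singleton]
  exact cyc_le hJ (hAJ (mem_span_singleton_self x))

omit hs in
lemma le_orbitSpan (A : Submodule F E) : A ≤ orbitSpan s A := le_sup_left.trans le_sup_left

lemma apply_mem_orbitSpan {A : Submodule F E} (hA : finrank F A = 1) :
    ∀ y ∈ orbitSpan s A, s y ∈ orbitSpan s A := by
  obtain ⟨x, hx, rfl⟩ := exists_eq_span_of_finrank_eq_one hA
  rw [orbitSpan_span_singleton]
  exact fun _ => apply_mem_cyc hs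

/-- The orbit of a non-fixed point spans at least two dimensions, hence all of any two-dimensional
invariant subspace containing it. -/
lemma orbitSpan_eq_eigenplane_iff {v : E} (hv : IsRegularVec s v) {t : F} (ht : t ^ 3 = 1)
    {A : Submodule F E} (hA : finrank F A = 1) :
    orbitSpan s A = eigenplane s v t ↔ A ≤ eigenplane s v t ∧ ¬ IsFixed s A := by
  rw [← finrank_orbitSpan_eq_one_iff hs hA]
  constructor
  · intro h
    refine ⟨h ▸ le_orbitSpan A, ?_⟩
    rw [h, hv.finrank_eigenplane hs ht]
    decide
  · rintro ⟨h1, h2⟩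
    have hle := orbitSpan_le hA h1 (fun y hy => apply_mem_eigenplane hs hy)
    have : FiniteDimensional F (eigenplane s v t) := by unfold eigenplane; infer_instance
    apply eq_of_le_of_finrank_le hle
    rw [hv.finrank_eigenplane hs ht]
    have := finrank_orbitSpan_mem (s := s) hA
    omega

lemma finrank_orbitSpan_eq_two_iff {v : E} (hv : IsRegularVec s v)
    {A : Submodule F E} (hA : finrank F A = 1) (hAv : A ≤ cyc s v) :
    finrank F (orbitSpan s A) = 2 ↔ ∃ t : F, t ^ 3 = 1 ∧ orbitSpan s A = eigenplane s v t := by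
  constructor
  · intro h
    exact hv.eq_eigenplane hs (orbitSpan_le hA hAv (fun _ => apply_mem_cyc hs))
      (apply_mem_orbitSpan hs hA) h
  · rintro ⟨t, ht, h⟩
    rw [h, hv.finrank_eigenplane hs ht]

variable [Finite F] [Finite E]

/-- Of the q + 1 points of the line, n + 1 are fixed. -/
lemma ncard_orbitSpan_eq_eigenplane {v : E} (hv : IsRegularVec s v) {n : ℤ}
    (hn : n = -1 ∨ n = 0 ∨ n = 1) (hqn : (Nat.card F : ℤ) ≡ n [ZMOD 3]) {t : F} (ht : t ^ 3 = 1) :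
    ({A : Submodule F E | finrank F A = 1 ∧ orbitSpan s A = eigenplane s v t}.ncard : ℤ) =
      Nat.card F - n := by
  have h1 := ncard_points _ (hv.finrank_eigenplane hs ht)
  have h2 := ncard_fixedPoints_eigenplane hs hv ht
  have h3 := ncard_quadraticRoots ht hn hqn
  have hun : {A : Submodule F E | A ≤ eigenplane s v t ∧ finrank F A = 1} =
      {A : Submodule F E | A ≤ eigenplane s v t ∧ IsFixedPoint s A} ∪
      {A : Submodule F E | finrank F A = 1 ∧ orbitSpan s A = eigenplane s v t} := by
    ext A
    simp only [Set.mem_ofPred_eq, Set.mem_union, IsFixedPoint]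
    by_cases hA : finrank F A = 1
    · rw [orbitSpan_eq_eigenplane_iff hs hv ht hA]
      tauto
    · tauto
  rw [hun, Set.ncard_union_eq _ (Set.toFinite _) (Set.toFinite _), h2] at h1
  · simp only [Finset.sum_range_succ, Finset.sum_range_zero, zero_add, pow_zero, pow_one] at h1
    replace h1 := congrArg (Nat.cast : ℕ → ℤ) h1
    simp only [Nat.cast_add, Nat.cast_one] at h1
    linarith
  · rw [Set.disjoint_left]
    rintro A ⟨-, hA, hfix⟩ ⟨-, h⟩
    exact ((orbitSpan_eq_eigenplane_iff hs hv ht hA).1 h).2 hfix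

lemma ncard_orbitSpan_mem {v : E} (hv : IsRegularVec s v) {n : ℤ}
    (hn : n = -1 ∨ n = 0 ∨ n = 1) (hqn : (Nat.card F : ℤ) ≡ n [ZMOD 3]) (T : Set F)
    (hT : ∀ t ∈ T, t ^ 3 = 1) :
    ({A : Submodule F E | finrank F A = 1 ∧ ∃ t ∈ T, orbitSpan s A = eigenplane s v t}.ncard : ℤ) =
      T.ncard * (Nat.card F - n) := by
  have hinj : Set.InjOn (eigenplane s v) T := fun t ht t' _ h => hv.eigenplane_injOn hs (hT t ht) h
  -- The common fibre size is expressed through one chosen element of `T`, so the empty set is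
  -- treated apart.
  rcases T.eq_empty_or_nonempty with rfl | ⟨t₀, ht₀⟩
  · simp
  have hk := ncard_orbitSpan_eq_eigenplane hs hv hn hqn (hT t₀ ht₀)
  rw [← hk, ← Nat.cast_mul, Nat.cast_inj, ← hinj.ncard_image]
  apply ncard_eq_ncard_mul_of_fibers (Set.toFinite _) (f := fun A => orbitSpan s A) _ (Set.toFinite _)
  · rintro _ ⟨t, ht, rfl⟩
    have : {a | a ∈ {A : Submodule F E | finrank F A = 1 ∧
        ∃ t ∈ T, orbitSpan s A = eigenplane s v t} ∧ orbitSpan s a = eigenplane s v t} =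
        {A : Submodule F E | finrank F A = 1 ∧ orbitSpan s A = eigenplane s v t} := by
      ext A
      exact ⟨fun h => ⟨h.1.1, h.2⟩, fun h => ⟨⟨h.1, t, ht, h.2⟩, h.2⟩⟩
    rw [this]
    have := ncard_orbitSpan_eq_eigenplane hs hv hn hqn (hT t ht)
    rw [← Nat.cast_inj (R := ℤ), this, hk]
  · rintro A ⟨-, t, ht, h⟩
    exact ⟨t, ht, h.symm⟩

/-- The number of points of a cyclic plane whose orbit spans the plane. -/
lemma ncard_orbitSpan_finrank_three {v : E} (hv : IsRegularVec s v) {n : ℤ}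
    (hn : n = -1 ∨ n = 0 ∨ n = 1) (hqn : (Nat.card F : ℤ) ≡ n [ZMOD 3]) :
    ({A : Submodule F E | A ≤ cyc s v ∧ finrank F A = 1 ∧ finrank F (orbitSpan s A) = 3}.ncard : ℤ) =
      Nat.card F ^ 2 + Nat.card F + 1 - {t : F | t ^ 3 = 1}.ncard * (Nat.card F - n + 1) := by
  have h1 := ncard_points (cyc s v) hv
  have h2 := ncard_fixedPoints_cyc hs hv
  have h3 := ncard_orbitSpan_mem hs hv hn hqn {t : F | t ^ 3 = 1} (fun _ h => h)
  -- The orbit of a point spans dimension 1 (fixed point), 2 (a single eigenplane) or 3.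
  have hun : {A : Submodule F E | A ≤ cyc s v ∧ finrank F A = 1} =
      ({A : Submodule F E | A ≤ cyc s v ∧ IsFixedPoint s A} ∪
      {A : Submodule F E | finrank F A = 1 ∧ ∃ t ∈ {t : F | t ^ 3 = 1},
        orbitSpan s A = eigenplane s v t}) ∪
      {A : Submodule F E | A ≤ cyc s v ∧ finrank F A = 1 ∧ finrank F (orbitSpan s A) = 3} := by
    ext A
    simp only [Set.mem_ofPred_eq, Set.mem_union, IsFixedPoint]
    constructor
    · rintro ⟨hAv, hA⟩
      rw [← finrank_orbitSpan_eq_one_iff hs hA, ← finrank_orbitSpan_eq_two_iff hs hv hA hAv]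
      have := finrank_orbitSpan_mem (s := s) hA
      have : finrank F (orbitSpan s A) = 1 ∨ finrank F (orbitSpan s A) = 2 ∨
        finrank F (orbitSpan s A) = 3 := by omega
      tauto
    · rintro ((h | ⟨h, t, -, ht⟩) | h)
      · exact ⟨h.1, h.2.1⟩
      · exact ⟨(le_orbitSpan A).trans (ht ▸ eigenplane_le hs v t), h⟩
      · exact ⟨h.1, h.2.1⟩
  rw [hun, Set.ncard_union_eq _ (Set.toFinite _) (Set.toFinite _),
    Set.ncard_union_eq _ (Set.toFinite _) (Set.toFinite _), h2] at h1
  · simp only [Finset.sum_range_succ, Finset.sum_range_zero, zero_add, pow_zero, pow_one] at h1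
    replace h1 := congrArg (Nat.cast : ℕ → ℤ) h1
    simp only [Nat.cast_add, Nat.cast_pow, Nat.cast_one] at h1
    rw [h3] at h1
    linarith
  · rw [Set.disjoint_left]
    rintro A ⟨-, hA, hfix⟩ ⟨-, t, ht, h⟩
    exact ((orbitSpan_eq_eigenplane_iff hs hv ht hA).1 h).2 hfix
  · rw [Set.disjoint_left]
    rintro A (⟨-, hA, hfix⟩ | ⟨hA, t, ht, h⟩) ⟨-, -, h'⟩
    · rw [(finrank_orbitSpan_eq_one_iff hs hA).2 hfix] at h'
      omega
    · rw [h, hv.finrank_eigenplane hs ht] at h'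
      omega

end CyclicCounting

/-! ### The map inducing a collineation is semilinear -/

section Semilinear
variable {F K V : Type*} [Field F] [Field K] [AddCommGroup V] [Module K V] [Module F V]
  [Algebra F K] [IsScalarTower F K V] {φ : Submodule K V ≃o Submodule K V} {σ : V ≃ₗ[F] V}

lemma Induces.apply_span (h : Induces σ φ) {x : V} (hx : x ≠ 0) :
    φ (span K {x}) = span K {σ x} := by
  have hmem : σ x ∈ φ (span K {x}) := by
    have := h (span K {x}) (finrank_span_singleton hx)
    rw [← restrictScalars_mem F, ← this]
    exact mem_map_of_mem (f := (σ : V →ₗ[F] V)) (mem_span_singleton_self x)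
  have hat : IsAtom (φ (span K {x})) := (φ.isAtom_iff _).2 (nonzero_span_atom x hx)
  rcases hat.le_iff.1 ((span_singleton_le_iff_mem _ _).2 hmem) with h0 | h1
  · rw [span_singleton_eq_bot, σ.map_eq_zero_iff] at h0
    exact absurd h0 hx
  · exact h1.symm

lemma Induces.exists_smul (h : Induces σ φ) (a : K) (x : V) : ∃ c : K, σ (a • x) = c • σ x := by
  by_cases hx : x = 0
  · exact ⟨0, by simp [hx]⟩
  have h1 := h (span K {x}) (finrank_span_singleton hx)
  rw [h.apply_span hx] at h1
  have : σ (a • x) ∈ (span K {σ x}).restrictScalars F := by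
    rw [← h1]
    exact mem_map_of_mem (f := (σ : V →ₗ[F] V)) (smul_mem _ a (mem_span_singleton_self x))
  obtain ⟨c, hc⟩ := mem_span_singleton.1 this
  exact ⟨c, hc.symm⟩

/-- The argument of the fundamental theorem of projective geometry: the multiplier e of x + y must
agree with those of x and y, because σx and σy are independent over `K`. -/
lemma Induces.smul_eq_of_notMem (h : Induces σ φ) {a c : K} {x y : V} (hx : x ≠ 0)
    (hy : y ∉ span K {x}) (hc : σ (a • x) = c • σ x) : σ (a • y) = c • σ y := by
  have hy0 : y ≠ 0 := by
    rintro rfl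
    exact hy (zero_mem _)
  obtain ⟨d, hd⟩ := h.exists_smul a y
  obtain ⟨e, he⟩ := h.exists_smul a (x + y)
  rw [smul_add, map_add, map_add, hc, hd] at he
  have h1 : (c - e) • σ x + (d - e) • σ y = 0 := by
    have : (c - e) • σ x + (d - e) • σ y = (c • σ x + d • σ y) - e • (σ x + σ y) := by module
    rw [this, he, sub_self]
  have hde : d - e = 0 := by
    by_contra hne
    have hmem : σ y ∈ span K {σ x} := by
      rw [← smul_mem_iff _ hne, eq_neg_of_add_eq_zero_right h1]
      exact neg_mem (smul_mem _ _ (mem_span_singleton_self _))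
    have hle : φ (span K {y}) ≤ φ (span K {x}) := by
      rw [h.apply_span hx, h.apply_span hy0]
      exact (span_singleton_le_iff_mem _ _).2 hmem
    exact hy ((span_singleton_le_iff_mem _ _).1 (φ.le_iff_le.1 hle))
  have hce : c - e = 0 := by
    rw [hde, zero_smul, add_zero] at h1
    exact (smul_eq_zero.1 h1).resolve_right (fun h => hx (σ.map_eq_zero_iff.1 h))
  rw [hd, sub_eq_zero.1 hde, sub_eq_zero.1 hce]

/-- Vectors on the `K`-line of x₀ are compared with x₀ through a third vector z off that line. -/
lemma Induces.exists_forall_smul (hV : finrank K V = 3) (h : Induces σ φ) (a : K) :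
    ∃ c : K, ∀ x, σ (a • x) = c • σ x := by
  have : Nontrivial V := nontrivial_of_finrank_pos (R := K) (by omega)
  have hne (x : V) : ∃ z, z ∉ span K {x} := by
    by_contra! hz
    have htop : span K {x} = ⊤ := eq_top_iff'.2 hz
    have := finrank_span_le_card (R := K) ({x} : Set V)
    rw [htop, finrank_top, hV] at this
    simp at this
  obtain ⟨x₀, hx₀⟩ := exists_ne (0 : V)
  obtain ⟨c, hc⟩ := h.exists_smul a x₀
  refine ⟨c, fun y => ?_⟩
  by_cases hy : y ∈ span K {x₀}
  · by_cases hy0 : y = 0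
    · simp [hy0]
    obtain ⟨z, hz⟩ := hne x₀
    have hz0 : z ≠ 0 := by
      rintro rfl
      exact hz (zero_mem _)
    refine h.smul_eq_of_notMem hz0 (fun hyz => hz ?_) (h.smul_eq_of_notMem hx₀ hz hc)
    obtain ⟨d, rfl⟩ := mem_span_singleton.1 hyz
    have hd : d ≠ 0 := by
      rintro rfl
      simp at hy0
    exact (smul_mem_iff _ hd).1 hy
  · exact h.smul_eq_of_notMem hx₀ hy hc

/-- The multiplier is determined by its action on the nonzero vector σx₀, so additivity and
associativity of scalar action make it a ring homomorphism. It fixes `F` because `σ` is `F`-linear,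
and its inverse is its square. -/
lemma Induces.exists_algEquiv (hV : finrank K V = 3) (hσ : ∀ x, σ (σ (σ x)) = x)
    (h : Induces σ φ) : ∃ τ : K ≃ₐ[F] K, (∀ a, τ (τ (τ a)) = a) ∧
      ∀ (a : K) (x : V), σ (a • x) = τ a • σ x := by
  have : Nontrivial V := nontrivial_of_finrank_pos (R := K) (by omega)
  obtain ⟨x₀, hx₀⟩ := exists_ne (0 : V)
  choose τ hτ using h.exists_forall_smul hV
  have hinj {a b : K} (hab : a • σ x₀ = b • σ x₀) : a = b :=
    smul_left_injective K (fun h => hx₀ (σ.map_eq_zero_iff.1 h)) hab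
  have hτ3 (a : K) : τ (τ (τ a)) = a := by
    apply smul_left_injective K hx₀
    have := hσ (a • x₀)
    rw [hτ, hτ, hτ, hσ] at this
    exact this
  let t : K →ₐ[F] K :=
    { toFun := τ
      map_one' := hinj (by rw [← hτ, one_smul, one_smul])
      map_mul' := fun a b => hinj (by rw [← hτ, mul_smul, hτ, hτ, mul_smul])
      map_zero' := hinj (by rw [← hτ, zero_smul, zero_smul, map_zero])
      map_add' := fun a b => hinj (by rw [← hτ, add_smul, map_add, hτ, hτ, add_smul])
      commutes' := fun r => hinj (by rw [← hτ, algebraMap_smul, map_smul, algebraMap_smul]) }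
  exact ⟨AlgEquiv.ofAlgHom t (t.comp t) (AlgHom.ext hτ3) (AlgHom.ext hτ3), hτ3, hτ⟩

/-- If τ were trivial, `σ` would be `K`-linear with every point of a subplane fixed, hence a scalar;
then `φ` would be the identity, against its order 3. -/
lemma Induces.exists_ne_of_isPlanar (hφ : IsPlanarOfOrderThree F φ) (h : Induces σ φ)
    {τ : K ≃ₐ[F] K} (hτ : ∀ (a : K) (x : V), σ (a • x) = τ a • σ x) : ∃ a, τ a ≠ a := by
  by_contra! hid
  obtain ⟨h3, B, ⟨b, rfl⟩, hfix⟩ := hφ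
  have hlin (a : K) (x : V) : σ (a • x) = a • σ x := by rw [hτ, hid]
  have heig (v : V) (hv : v ∈ span F (Set.range b)) (hv0 : v ≠ 0) : ∃ c : K, σ v = c • v := by
    have := hfix _ ⟨v, hv, hv0, rfl⟩
    rw [h.apply_span hv0] at this
    obtain ⟨c, hc⟩ := mem_span_singleton.1 (this ▸ mem_span_singleton_self (R := K) (σ v))
    exact ⟨c, hc.symm⟩
  have hbmem (i : Fin 3) : b i ∈ span F (Set.range b) := subset_span ⟨i, rfl⟩
  choose c hc using fun i => heig (b i) (hbmem i) (b.ne_zero i)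
  -- The point of b i + b 0 also lies in the subplane, which forces equal eigenvalues.
  have hcc (i : Fin 3) : c i = c 0 := by
    by_cases hi : i = 0
    · rw [hi]
    have hli := b.linearIndependent
    have hne : b i + b 0 ≠ 0 := by
      intro h0
      have := congrArg (fun v => b.repr v i) h0
      simp [Ne.symm hi] at this
    obtain ⟨d, hd⟩ := heig (b i + b 0) (add_mem (hbmem i) (hbmem 0)) hne
    rw [map_add, hc, hc] at hd
    have h1 := congrArg (fun v => b.repr v i) hd
    have h2 := congrArg (fun v => b.repr v 0) hd
    simp [Ne.symm hi, hi] at h1 h2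
    rw [h1, h2]
  have hscal (x : V) : σ x = c 0 • x := by
    let f : V →ₗ[K] V := { toFun := σ, map_add' := map_add σ, map_smul' := hlin }
    have : f = c 0 • LinearMap.id := b.ext fun i => by
      change σ (b i) = c 0 • b i
      rw [hc, hcc]
    exact LinearMap.congr_fun this x
  have hpt (x : V) : φ (span K {x}) = span K {x} := by
    by_cases hx : x = 0
    · subst hx
      rw [span_singleton_eq_bot.2 rfl, φ.map_bot]
    rw [h.apply_span hx, hscal]
    refine span_singleton_smul_eq (isUnit_iff_ne_zero.2 fun h0 => ?_) x
    have := hscal x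
    rw [h0, zero_smul, σ.map_eq_zero_iff] at this
    exact hx this
  have h1 : φ = 1 := by
    ext S x
    change x ∈ φ S ↔ x ∈ S
    rw [← span_singleton_le_iff_mem, ← hpt, φ.le_iff_le, span_singleton_le_iff_mem]
  rw [h1, orderOf_one] at h3
  omega

end Semilinear

/-! ### Galois descent and the rank of the matrix of conjugates -/

section Descent
variable {F K V : Type*} [Field F] [Field K] [Algebra F K] [FiniteDimensional F K]
  {τ : K ≃ₐ[F] K}

/-- The vector of conjugates of an element. -/
def conj (τ : K ≃ₐ[F] K) (x : K) : Fin 3 → K := ![x, τ x, τ (τ x)]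

/-- Dedekind's independence of characters; 1, τ, τ² are distinct, since τ² = 1 and τ³ = 1 would give
τ = 1. -/
lemma linearIndependent_powers (hτ3 : ∀ a, τ (τ (τ a)) = a) (hτ : ∃ a, τ a ≠ a) :
    LinearIndependent K (![LinearMap.id, τ.toLinearMap, τ.toLinearMap ∘ₗ τ.toLinearMap] :
      Fin 3 → K →ₗ[F] K) := by
  obtain ⟨a, ha⟩ := hτ
  have hinj : Function.Injective
      (![AlgHom.id F K, τ.toAlgHom, τ.toAlgHom.comp τ.toAlgHom] : Fin 3 → K →ₐ[F] K) := by
    have h01 : AlgHom.id F K ≠ τ.toAlgHom := fun h => ha (DFunLike.congr_fun h a).symm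
    have h02 : AlgHom.id F K ≠ τ.toAlgHom.comp τ.toAlgHom := fun h => by
      have h2 : a = τ (τ a) := DFunLike.congr_fun h a
      apply ha
      conv_rhs => rw [← hτ3 a]
      rw [← h2]
    have h12 : τ.toAlgHom ≠ τ.toAlgHom.comp τ.toAlgHom := fun h => by
      have h2 : τ a = τ (τ a) := DFunLike.congr_fun h a
      exact ha (τ.injective h2).symm
    intro i j h
    fin_cases i <;> fin_cases j <;> first | rfl | skip
    exacts [absurd h h01, absurd h h02, absurd h.symm h01, absurd h h12, absurd h.symm h02,
      absurd h.symm h12]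
  have h := (linearIndependent_algHom_toLinearMap F K K).comp _ hinj
  have heq : (![LinearMap.id, τ.toLinearMap, τ.toLinearMap ∘ₗ τ.toLinearMap] :
      Fin 3 → K →ₗ[F] K) = AlgHom.toLinearMap ∘
      (![AlgHom.id F K, τ.toAlgHom, τ.toAlgHom.comp τ.toAlgHom] : Fin 3 → K →ₐ[F] K) := by
    ext i x
    fin_cases i <;> rfl
  rw [heq]
  exact h

variable (hτ3 : ∀ a, τ (τ (τ a)) = a) (hτ : ∃ a, τ a ≠ a)
include hτ3 hτ

/-- The matrix of conjugates of a basis has independent rows by Dedekind, so its columns span. -/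
lemma span_conj_basis {ι : Type*} (e : Basis ι F K) :
    span K (Set.range fun k => conj τ (e k)) = ⊤ := by
  have h := (linearIndependent_powers hτ3 hτ).map' _ (e.constr K).symm.ker
  rw [← span_flip_eq_top_iff_linearIndependent] at h
  rw [← h]
  congr 2
  ext k i
  fin_cases i <;> simp [flip, conj, Basis.constr]

/-- Extended to an `F`-basis of `K`, the family has three conjugate vectors, and these span K³. -/
lemma linearIndependent_conj (hK : finrank F K = 3) {ι : Type*} {l : ι → K}
    (hl : LinearIndependent F l) : LinearIndependent K fun i => conj τ (l i) := by
  let e := Basis.sumExtend hl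
  have := FiniteDimensional.fintypeBasisIndex e
  have h : LinearIndependent K fun k => conj τ (e k) := by
    apply linearIndependent_of_top_le_span_of_card_eq_finrank (span_conj_basis hτ3 hτ e).ge
    rw [← finrank_eq_card_basis e, hK, finrank_fintype_fun_eq_card, Fintype.card_fin]
  have h2 := h.comp Sum.inl Sum.inl_injective
  have he (i : ι) : e (Sum.inl i) = l i := by
    simp [e, Basis.sumExtend]
    rfl
  simpa only [Function.comp_def, he] using h2

omit hτ3 hτ [FiniteDimensional F K] in
lemma conj_add (x y : K) : conj τ (x + y) = conj τ x + conj τ y := by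
  ext i
  fin_cases i <;> simp [conj]

omit hτ3 hτ [FiniteDimensional F K] in
lemma conj_smul (c : F) (x : K) : conj τ (c • x) = c • conj τ x := by
  ext i
  fin_cases i <;> simp [conj]

/-- Conjugation as a linear map. -/
def conjₗ (τ : K ≃ₐ[F] K) : K →ₗ[F] (Fin 3 → K) where
  toFun := conj τ
  map_add' := conj_add
  map_smul' := conj_smul

lemma finrank_span_conj (hK : finrank F K = 3) (s : Set K) :
    finrank K (span K (conj τ '' s)) = finrank F (span F s) := by
  have h : span K (conj τ '' s) = span K (conj τ '' (span F s : Set K)) := by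
    apply le_antisymm (span_mono (Set.image_mono subset_span))
    rw [span_le]
    have : span F (conjₗ τ '' s) ≤ (span K (conj τ '' s)).restrictScalars F := by
      rw [span_le]
      exact subset_span
    rintro _ ⟨x, hx, rfl⟩
    apply this
    rw [← map_span]
    exact mem_map_of_mem hx
  let e := Module.finBasis F (span F s)
  have he : span K (conj τ '' (span F s : Set K)) =
      span K (Set.range fun i => conj τ (e i : K)) := by
    apply le_antisymm
    · rw [span_le]
      have : span F (Set.range fun i => conjₗ τ (e i : K)) ≤
          (span K (Set.range fun i => conj τ (e i : K))).restrictScalars F := by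
        rw [span_le]
        exact subset_span
      rintro _ ⟨x, hx, rfl⟩
      apply this
      have hx2 : x = ∑ i, e.repr ⟨x, hx⟩ i • (e i : K) := by
        have := congrArg (span F s).subtype (e.sum_repr ⟨x, hx⟩)
        simp only [map_sum, map_smul] at this
        exact this.symm
      have : conj τ x = ∑ i, e.repr ⟨x, hx⟩ i • conjₗ τ (e i : K) := by
        change conjₗ τ x = _
        conv_lhs => rw [hx2]
        rw [map_sum]
        simp
      rw [this]
      exact sum_mem fun i _ => smul_mem _ _ (subset_span ⟨i, rfl⟩)
    · rw [span_le]
      rintro _ ⟨i, rfl⟩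
      exact subset_span ⟨e i, (e i).2, rfl⟩
  have hli : LinearIndependent F fun i => (e i : K) :=
    e.linearIndependent.map' (span F s).subtype (ker_subtype _)
  rw [h, he, finrank_span_eq_card (linearIndependent_conj hτ3 hτ hK hli), Fintype.card_fin]

variable [AddCommGroup V] [Module K V] [Module F V] [IsScalarTower F K V] {σ : V ≃ₗ[F] V}

/-- The traces ev + τ(e)σv + τ²(e)σ²v are fixed by `σ`. As e runs over a basis the vectors `conj τ
e` span K³, so some `K`-combination of the traces equals v. -/
lemma span_fixed_eq_top (hσ3 : ∀ x, σ (σ (σ x)) = x)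
    (hσ : ∀ (a : K) (x : V), σ (a • x) = τ a • σ x) : span K {w : V | σ w = w} = ⊤ := by
  rw [eq_top_iff']
  intro v
  let e := Module.finBasis F K
  have h : (Pi.single 0 1 : Fin 3 → K) ∈ span K (Set.range fun k => conj τ (e k)) := by
    rw [span_conj_basis hτ3 hτ e]
    exact mem_top
  obtain ⟨c, hc⟩ := (mem_span_range_iff_exists_fun K).1 h
  -- `f` sends `conj τ (e k)` to the trace belonging to e k, and the first unit vector to v.
  let f : (Fin 3 → K) →ₗ[K] V := Fintype.linearCombination K ![v, σ v, σ (σ v)]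
  have hf : f (Pi.single 0 1) = v := by simp [f]
  rw [← hf, ← hc, map_sum]
  refine sum_mem fun k _ => ?_
  rw [map_smul]
  refine smul_mem _ _ (subset_span ?_)
  change σ _ = _
  simp only [f, Fintype.linearCombination_apply, Fin.sum_univ_three, conj, Matrix.cons_val_zero,
    Matrix.cons_val_one, Matrix.cons_val, map_add, hσ, hτ3, hσ3]
  abel

lemma exists_fixed_basis (hV : finrank K V = 3) (hσ3 : ∀ x, σ (σ (σ x)) = x)
    (hσ : ∀ (a : K) (x : V), σ (a • x) = τ a • σ x) :
    ∃ b : Basis (Fin 3) K V, ∀ i, σ (b i) = b i := by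
  obtain ⟨t, hts, htspan, hli⟩ := exists_linearIndependent K {w : V | σ w = w}
  rw [span_fixed_eq_top hτ3 hτ hσ3 hσ] at htspan
  let b : Basis t K V := Basis.mk hli (by rw [Subtype.range_coe, htspan])
  have : FiniteDimensional K V := FiniteDimensional.of_finrank_pos (by omega)
  have := FiniteDimensional.fintypeBasisIndex b
  have hcard : Fintype.card t = 3 := by rw [← finrank_eq_card_basis b, hV]
  refine ⟨b.reindex (Fintype.equivFinOfCardEq hcard), fun i => ?_⟩
  rw [Basis.reindex_apply, Basis.mk_apply]
  exact hts (Subtype.prop _)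

omit hτ3 hτ [FiniteDimensional F K] in
lemma repr_apply {b : Basis (Fin 3) K V} (hb : ∀ i, σ (b i) = b i)
    (hσ : ∀ (a : K) (x : V), σ (a • x) = τ a • σ x) (v : V) (i : Fin 3) :
    b.repr (σ v) i = τ (b.repr v i) := by
  conv_lhs => rw [← b.sum_repr v]
  simp only [map_sum, hσ, hb, Finsupp.coe_finsetSum, Finset.sum_apply, map_smul,
    Finsupp.smul_apply, Basis.repr_self, smul_eq_mul, Finsupp.single_apply]
  simp

/-- The span of the coordinates of a vector. -/
def coordSpan (F : Type*) {K V : Type*} [Field F] [Field K] [Algebra F K] [AddCommGroup V]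
    [Module K V] (b : Basis (Fin 3) K V) (v : V) : Submodule F K :=
  span F (Set.range (b.repr v))

/-- The dimension over the large field of the span of a subspace over the small field. -/
noncomputable def rk (K : Type*) {F V : Type*} [Field F] [Field K] [AddCommGroup V] [Module K V]
    [Module F V] (S : Submodule F V) : ℕ := finrank K (span K (S : Set V))

/-- In the matrix with entries τⁱ(vⱼ) the rows are the coordinates of v, σv, σ²v and the columns are
the conjugate vectors of the coordinates of v. Row rank equals column rank, and `finrank_span_conj`
turns the latter into a dimension over `F`. -/
lemma rk_cyc (hK : finrank F K = 3) {b : Basis (Fin 3) K V} (hb : ∀ i, σ (b i) = b i)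
    (hσ : ∀ (a : K) (x : V), σ (a • x) = τ a • σ x) (v : V) :
    rk K (cyc σ v) = finrank F (coordSpan F b v) := by
  have hr := repr_apply hb hσ
  let M : Matrix (Fin 3) (Fin 3) K := Matrix.of fun i j => conj τ (b.repr v j) i
  have h1 : M.rank = finrank F (coordSpan F b v) := by
    rw [Matrix.rank_eq_finrank_span_cols, coordSpan, ← finrank_span_conj hτ3 hτ hK, ← Set.range_comp]
    rfl
  have hrange : Set.range M.row = b.equivFun '' Set.range ![v, σ v, σ (σ v)] := by
    rw [← Set.range_comp]
    congr 1
    funext i j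
    fin_cases i <;> simp [M, conj, hr]
  have h2 : M.rank = rk K (cyc σ v) := by
    rw [Matrix.rank_eq_finrank_span_row, rk, cyc_eq_span_range, Submodule.span_span_of_tower,
      ← LinearEquiv.finrank_map_eq b.equivFun, map_span, hrange]
    rfl
  rw [← h2, h1]

end Descent

/-! ### Types of points and fixed lines read off from ranks over K -/

section Types
variable {F K V : Type*} [Field F] [Field K] [AddCommGroup V] [Module K V] [Module F V]
  [Algebra F K] [IsScalarTower F K V] {φ : Submodule K V ≃o Submodule K V} {σ : V ≃ₗ[F] V}

lemma span_cyc_eq (hσφ : Induces σ φ) {x : V} (hx : x ≠ 0) :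
    span K (cyc σ x : Set V) = span K {x} ⊔ φ (span K {x}) ⊔ φ (φ (span K {x})) := by
  have hx' : σ x ≠ 0 := fun h => hx (σ.map_eq_zero_iff.1 h)
  rw [cyc, Submodule.span_span_of_tower, hσφ.apply_span hx, hσφ.apply_span hx', ← span_union,
    ← span_union]
  congr 1
  ext y
  simp only [Set.mem_union, Set.mem_insert_iff, Set.mem_singleton_iff, or_assoc]

lemma eq_span_of_mem {P : Submodule K V} (hP : finrank K P = 1) {x : V} (hx : x ≠ 0)
    (hxP : x ∈ P) : P = span K {x} := by
  have : FiniteDimensional K P := FiniteDimensional.of_finrank_pos (by omega)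
  exact (eq_of_le_of_finrank_eq ((span_singleton_le_iff_mem _ _).2 hxP)
    ((finrank_span_singleton hx).trans hP.symm)).symm

/-- The only spread plane through ⟨x⟩ is that of `K`x, and the `K`-span of the orbit of x is the
join of its three images under `φ`. -/
lemma isIPoint_iff (hσφ : Induces σ φ) {A : Submodule F V} :
    IsIPoint φ A ↔ finrank F A = 1 ∧ rk K (orbitSpan σ A) = 1 := by
  refine and_congr_right fun hA => ?_
  obtain ⟨x, hx, rfl⟩ := exists_eq_span_of_finrank_eq_one hA
  have hx' : σ x ≠ 0 := fun h => hx (σ.map_eq_zero_iff.1 h)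
  rw [orbitSpan_span_singleton, rk, span_cyc_eq hσφ hx]
  constructor
  · rintro ⟨P, ⟨hP, hfix⟩, hxP⟩
    have := eq_span_of_mem hP hx (hxP (mem_span_singleton_self x))
    subst this
    rw [hfix, hfix, sup_idem, sup_idem, hP]
  · intro h
    refine ⟨span K {x}, ⟨finrank_span_singleton hx, ?_⟩,
      (span_singleton_le_iff_mem _ _).2 (mem_span_singleton_self x)⟩
    have h1 : span K {x} ≤ span K {x} ⊔ φ (span K {x}) ⊔ φ (φ (span K {x})) :=
      le_sup_left.trans le_sup_left
    have h2 : φ (span K {x}) ≤ span K {x} ⊔ φ (span K {x}) ⊔ φ (φ (span K {x})) :=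
      le_sup_right.trans le_sup_left
    have : FiniteDimensional K ↥(span K {x} ⊔ φ (span K {x}) ⊔ φ (φ (span K {x}))) :=
      FiniteDimensional.of_finrank_pos (by omega)
    rw [← eq_of_le_of_finrank_eq h1 ((finrank_span_singleton hx).trans h.symm)] at h2
    refine eq_of_le_of_finrank_eq h2 ?_
    rw [hσφ.apply_span hx, finrank_span_singleton hx, finrank_span_singleton hx']

lemma isIIPoint_iff (hσφ : Induces σ φ) {A : Submodule F V} :
    IsIIPoint φ A ↔ finrank F A = 1 ∧ rk K (orbitSpan σ A) = 2 := by
  refine and_congr_right fun hA => ?_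
  obtain ⟨x, hx, rfl⟩ := exists_eq_span_of_finrank_eq_one hA
  rw [orbitSpan_span_singleton, rk, span_cyc_eq hσφ hx]
  constructor
  · rintro ⟨P, ⟨hP, h⟩, hxP⟩
    rw [← eq_span_of_mem hP hx (hxP (mem_span_singleton_self x)), h]
  · intro h
    exact ⟨span K {x}, ⟨finrank_span_singleton hx, h⟩,
      (span_singleton_le_iff_mem _ _).2 (mem_span_singleton_self x)⟩

/-- A point with collinear orbit whose span has rank `r` over `K`. -/
def IsCollinearOfRk (K : Type*) {F V : Type*} [Field F] [Field K] [AddCommGroup V] [Module K V]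
    [Module F V] (σ : V ≃ₗ[F] V) (r : ℕ) (A : Submodule F V) : Prop :=
  finrank F A = 1 ∧ rk K (orbitSpan σ A) = r ∧ finrank F (orbitSpan σ A) = 2

lemma isICollinearPoint_iff (hσφ : Induces σ φ) {A : Submodule F V} :
    IsICollinearPoint φ σ A ↔ IsCollinearOfRk K σ 1 A := by
  rw [IsICollinearPoint, isIPoint_iff hσφ, IsCollinearOfRk, and_assoc]

lemma isIICollinearPoint_iff (hσφ : Induces σ φ) {A : Submodule F V} :
    IsIICollinearPoint φ σ A ↔ IsCollinearOfRk K σ 2 A := by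
  rw [IsIICollinearPoint, isIIPoint_iff hσφ, IsCollinearOfRk, and_assoc]

variable [Finite F] [Finite V] (hσ : ∀ x, σ (σ (σ x)) = x)
include hσ

lemma isFixedIIPlane_iff (hσφ : Induces σ φ) {S : Submodule F V} :
    IsFixedIIPlane φ σ S ↔ ∃ v, IsRegularVec σ v ∧ rk K (cyc σ v) = 2 ∧ S = cyc σ v := by
  constructor
  · rintro ⟨h3, hfix, A, hAS, hA, hAo⟩
    rw [isIIPoint_iff hσφ] at hA
    obtain ⟨v, hv, rfl⟩ := exists_eq_span_of_finrank_eq_one hA.1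
    rw [orbitSpan_span_singleton] at hA hAo
    refine ⟨v, hAo, hA.2, (eq_of_le_of_finrank_eq ?_ (hAo.trans h3.symm)).symm⟩
    exact cyc_le (isFixed_iff_mapsTo.1 hfix) (hAS (mem_span_singleton_self v))
  · rintro ⟨v, hv, h2, rfl⟩
    refine ⟨hv, isFixed_iff_mapsTo.2 fun _ => apply_mem_cyc hσ, span F {v},
      (span_singleton_le_iff_mem _ _).2 (self_mem_cyc v), (isIIPoint_iff hσφ).2 ?_, ?_⟩
    · rw [orbitSpan_span_singleton]
      exact ⟨finrank_span_singleton hv.ne_zero, h2⟩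
    · rw [orbitSpan_span_singleton]
      exact hv

/-- The eigenvalues whose invariant plane has rank `r` over `K`. -/
def eigenvaluesOfRk (K : Type*) {F V : Type*} [Field F] [Field K] [AddCommGroup V] [Module K V]
    [Module F V] (σ : V ≃ₗ[F] V) (v : V) (r : ℕ) : Set F :=
  {t | t ^ 3 = 1 ∧ rk K (eigenplane σ v t) = r}

lemma collinearPoints_cyc_eq {v : V} (hv : IsRegularVec σ v) (r : ℕ) :
    {A : Submodule F V | A ≤ cyc σ v ∧ IsCollinearOfRk K σ r A} =
      {A : Submodule F V | finrank F A = 1 ∧ ∃ t ∈ eigenvaluesOfRk K σ v r,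
        orbitSpan σ A = eigenplane σ v t} := by
  ext A
  constructor
  · rintro ⟨hAv, hA, hr, h2⟩
    obtain ⟨t, ht, h⟩ := (finrank_orbitSpan_eq_two_iff hσ hv hA hAv).1 h2
    exact ⟨hA, t, ⟨ht, h ▸ hr⟩, h⟩
  · rintro ⟨hA, t, ⟨ht, hr⟩, h⟩
    refine ⟨(le_orbitSpan A).trans (h ▸ eigenplane_le hσ v t), hA, h ▸ hr, ?_⟩
    rw [h, hv.finrank_eigenplane hσ ht]

/-- A triangle orbit spans the whole plane, so its point inherits rank 2, i.e. is automatically a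
II-point. -/
lemma trianglePoints_cyc_eq (hσφ : Induces σ φ) {v : V} (hv : IsRegularVec σ v)
    (h2 : rk K (cyc σ v) = 2) :
    {A : Submodule F V | A ≤ cyc σ v ∧ IsIITrianglePoint φ σ A} =
      {A | A ≤ cyc σ v ∧ finrank F A = 1 ∧ finrank F (orbitSpan σ A) = 3} := by
  ext A
  simp only [Set.mem_ofPred_eq, IsIITrianglePoint, isIIPoint_iff hσφ]
  constructor
  · rintro ⟨h, ⟨hA, -⟩, h3⟩
    exact ⟨h, hA, h3⟩
  · rintro ⟨h, hA, h3⟩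
    refine ⟨h, ⟨hA, ?_⟩, h3⟩
    rw [eq_of_le_of_finrank_eq (orbitSpan_le hA h fun _ => apply_mem_cyc hσ) (h3.trans hv.symm), h2]

lemma exists_orbitSpan_eq_eigenplane {v : V} (hv : IsRegularVec σ v) {n : ℤ}
    (hn : n = -1 ∨ n = 0 ∨ n = 1) (hqn : (Nat.card F : ℤ) ≡ n [ZMOD 3]) (hq : 2 < Nat.card F)
    {t : F} (ht : t ^ 3 = 1) :
    ∃ A : Submodule F V, finrank F A = 1 ∧ orbitSpan σ A = eigenplane σ v t := by
  have h := ncard_orbitSpan_eq_eigenplane hσ hv hn hqn ht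
  have : {A : Submodule F V | finrank F A = 1 ∧ orbitSpan σ A = eigenplane σ v t}.Nonempty := by
    rw [← Set.ncard_pos (Set.toFinite _)]
    omega
  exact this

/-- A point with collinear orbit spans the fixed line containing it, so both have the same rank;
conversely each eigenplane contains such a point because q − n > 0. -/
lemma fixedLines_cyc_eq {v : V} (hv : IsRegularVec σ v) {n : ℤ}
    (hn : n = -1 ∨ n = 0 ∨ n = 1) (hqn : (Nat.card F : ℤ) ≡ n [ZMOD 3]) (hq : 2 < Nat.card F)
    (r : ℕ) :
    {l : Submodule F V | l ≤ cyc σ v ∧ finrank F l = 2 ∧ IsFixed σ l ∧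
      ∃ A ≤ l, IsCollinearOfRk K σ r A} = eigenplane σ v '' eigenvaluesOfRk K σ v r := by
  ext l
  constructor
  · rintro ⟨hlv, hl, hfix, A, hAl, hA, hr, hA2⟩
    rw [isFixed_iff_mapsTo] at hfix
    obtain ⟨t, ht, rfl⟩ := hv.eq_eigenplane hσ hlv hfix hl
    refine ⟨t, ⟨ht, ?_⟩, rfl⟩
    rw [← hr, eq_of_le_of_finrank_eq (orbitSpan_le hA hAl hfix) (hA2.trans hl.symm)]
  · rintro ⟨t, ⟨ht, hr⟩, rfl⟩
    obtain ⟨A, hA, h⟩ := exists_orbitSpan_eq_eigenplane hσ hv hn hqn hq ht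
    refine ⟨eigenplane_le hσ v t, hv.finrank_eigenplane hσ ht,
      isFixed_iff_mapsTo.2 fun _ => apply_mem_eigenplane hσ, A, h ▸ le_orbitSpan A, hA, h ▸ hr, ?_⟩
    rw [h, hv.finrank_eigenplane hσ ht]

lemma ncard_fixedLines_cyc {v : V} (hv : IsRegularVec σ v) {n : ℤ}
    (hn : n = -1 ∨ n = 0 ∨ n = 1) (hqn : (Nat.card F : ℤ) ≡ n [ZMOD 3]) (hq : 2 < Nat.card F)
    (r : ℕ) :
    {l : Submodule F V | l ≤ cyc σ v ∧ finrank F l = 2 ∧ IsFixed σ l ∧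
      ∃ A ≤ l, IsCollinearOfRk K σ r A}.ncard = (eigenvaluesOfRk K σ v r).ncard := by
  rw [fixedLines_cyc_eq hσ hv hn hqn hq]
  exact Set.InjOn.ncard_image fun t ht t' _ h => hv.eigenplane_injOn hσ ht.1 h

lemma rk_eigenplane {v : V} (hv : IsRegularVec σ v) (h2 : rk K (cyc σ v) = 2) {t : F}
    (ht : t ^ 3 = 1) : rk K (eigenplane σ v t) = 1 ∨ rk K (eigenplane σ v t) = 2 := by
  have : rk K (eigenplane σ v t) ≤ rk K (cyc σ v) :=
    finrank_mono (span_mono (eigenplane_le hσ v t))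
  have : rk K (eigenplane σ v t) ≠ 0 := by
    intro h0
    rw [rk, finrank_eq_zero, span_eq_bot] at h0
    have hbot : eigenplane σ v t = ⊥ := (Submodule.eq_bot_iff _).2 h0
    have := hv.finrank_eigenplane hσ ht
    rw [hbot, finrank_bot] at this
    omega
  omega

/-- Two eigenplanes share a nonzero x by dimension. If both have rank 1, both lie in `K`x, and so
does their sum, the whole plane, against rank 2. -/
lemma eigenvaluesOfRk_one_subsingleton {v : V} (hv : IsRegularVec σ v) (h2 : rk K (cyc σ v) = 2) :
    (eigenvaluesOfRk K σ v 1).Subsingleton := by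
  rintro t ⟨ht, hr⟩ t' ⟨ht', hr'⟩
  by_contra hne
  have hJ := hv.finrank_eigenplane hσ ht
  have hJ' := hv.finrank_eigenplane hσ ht'
  have hsum := finrank_sup_add_finrank_inf_eq (eigenplane σ v t) (eigenplane σ v t')
  have hle : eigenplane σ v t ⊔ eigenplane σ v t' ≤ cyc σ v :=
    sup_le (eigenplane_le hσ v t) (eigenplane_le hσ v t')
  have h3 := finrank_mono hle
  rw [hv] at h3
  have hlt : eigenplane σ v t < eigenplane σ v t ⊔ eigenplane σ v t' := by
    rw [left_lt_sup]
    intro h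
    exact hne (hv.eigenplane_injOn hσ ht
      (eq_of_le_of_finrank_eq h (hJ'.trans hJ.symm)).symm)
  have h4 := finrank_lt_finrank_of_lt hlt
  have hsup : eigenplane σ v t ⊔ eigenplane σ v t' = cyc σ v :=
    eq_of_le_of_finrank_eq hle (by rw [hv]; omega)
  have hinf : (eigenplane σ v t ⊓ eigenplane σ v t') ≠ ⊥ := by
    intro h
    rw [h, finrank_bot] at hsum
    omega
  obtain ⟨x, ⟨hx1, hx2⟩, hx0⟩ := exists_mem_ne_zero_of_ne_bot hinf
  have e1 := eq_span_of_mem hr hx0 (subset_span hx1)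
  have e2 := eq_span_of_mem hr' hx0 (subset_span hx2)
  have : span K (cyc σ v : Set V) ≤ span K {x} := by
    rw [span_le, ← hsup]
    have : eigenplane σ v t ⊔ eigenplane σ v t' ≤ (span K {x}).restrictScalars F := by
      refine sup_le ?_ ?_
      · rw [← e1]
        exact subset_span
      · rw [← e2]
        exact subset_span
    exact this
  have := finrank_mono this
  rw [finrank_span_singleton hx0] at this
  rw [rk] at h2
  omega

lemma ncard_eigenvalues_add {v : V} (hv : IsRegularVec σ v) (h2 : rk K (cyc σ v) = 2) :
    (eigenvaluesOfRk K σ v 1).ncard + (eigenvaluesOfRk K σ v 2).ncard =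
      {t : F | t ^ 3 = 1}.ncard := by
  rw [← Set.ncard_union_eq _ (Set.toFinite _) (Set.toFinite _)]
  · congr 1
    ext t
    constructor
    · rintro (h | h) <;> exact h.1
    · intro ht
      rcases rk_eigenplane hσ hv h2 ht with h | h
      exacts [Or.inl ⟨ht, h⟩, Or.inr ⟨ht, h⟩]
  · rw [Set.disjoint_left]
    rintro t ⟨-, h⟩ ⟨-, h'⟩
    omega

lemma ncard_fixedILines_cyc (hσφ : Induces σ φ) {v : V} (hv : IsRegularVec σ v) {n : ℤ}
    (hn : n = -1 ∨ n = 0 ∨ n = 1) (hqn : (Nat.card F : ℤ) ≡ n [ZMOD 3]) (hq : 2 < Nat.card F) :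
    {l : Submodule F V | l ≤ cyc σ v ∧ IsFixedILine φ σ l}.ncard =
      (eigenvaluesOfRk K σ v 1).ncard := by
  simp only [IsFixedILine, isICollinearPoint_iff hσφ]
  exact ncard_fixedLines_cyc hσ hv hn hqn hq 1

lemma ncard_fixedIILines_cyc (hσφ : Induces σ φ) {v : V} (hv : IsRegularVec σ v) {n : ℤ}
    (hn : n = -1 ∨ n = 0 ∨ n = 1) (hqn : (Nat.card F : ℤ) ≡ n [ZMOD 3]) (hq : 2 < Nat.card F) :
    {l : Submodule F V | l ≤ cyc σ v ∧ IsFixedIILine φ σ l}.ncard =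
      (eigenvaluesOfRk K σ v 2).ncard := by
  simp only [IsFixedIILine, isIICollinearPoint_iff hσφ]
  exact ncard_fixedLines_cyc hσ hv hn hqn hq 2

omit hσ [Finite F] in
lemma existsUnique_iff_ncard (S : Submodule F V) (p : Submodule F V → Prop) :
    (∃! l, l ≤ S ∧ p l) ↔ {l | l ≤ S ∧ p l}.ncard = 1 := by
  rw [Set.ncard_eq_one]
  constructor
  · rintro ⟨l, hl, h⟩
    exact ⟨l, Set.eq_singleton_iff_unique_mem.2 ⟨hl, h⟩⟩
  · rintro ⟨l, hl⟩
    obtain ⟨h1, h2⟩ := Set.eq_singleton_iff_unique_mem.1 hl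
    exact ⟨l, h1, h2⟩

omit hσ [Finite F] in
lemma not_exists_iff_ncard (S : Submodule F V) (p : Submodule F V → Prop) :
    (¬ ∃ l, l ≤ S ∧ p l) ↔ {l | l ≤ S ∧ p l}.ncard = 0 := by
  rw [Set.ncard_eq_zero (Set.toFinite _), Set.eq_empty_iff_forall_notMem, not_exists]
  rfl

lemma isFixedII₁Plane_iff (hσφ : Induces σ φ) {n : ℤ}
    (hn : n = -1 ∨ n = 0 ∨ n = 1) (hqn : (Nat.card F : ℤ) ≡ n [ZMOD 3]) (hq : 2 < Nat.card F)
    {S : Submodule F V} :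
    IsFixedII₁Plane φ σ S ↔ ∃ v, IsRegularVec σ v ∧ rk K (cyc σ v) = 2 ∧
      (eigenvaluesOfRk K σ v 1).ncard = 1 ∧ S = cyc σ v := by
  rw [IsFixedII₁Plane, isFixedIIPlane_iff hσ hσφ, existsUnique_iff_ncard]
  constructor
  · rintro ⟨⟨v, hv, h2, rfl⟩, h⟩
    rw [ncard_fixedILines_cyc hσ hσφ hv hn hqn hq] at h
    exact ⟨v, hv, h2, h, rfl⟩
  · rintro ⟨v, hv, h2, h, rfl⟩
    rw [ncard_fixedILines_cyc hσ hσφ hv hn hqn hq]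
    exact ⟨⟨v, hv, h2, rfl⟩, h⟩

lemma isFixedII₂Plane_iff (hσφ : Induces σ φ) {n : ℤ}
    (hn : n = -1 ∨ n = 0 ∨ n = 1) (hqn : (Nat.card F : ℤ) ≡ n [ZMOD 3]) (hq : 2 < Nat.card F)
    {S : Submodule F V} :
    IsFixedII₂Plane φ σ S ↔ ∃ v, IsRegularVec σ v ∧ rk K (cyc σ v) = 2 ∧
      (eigenvaluesOfRk K σ v 1).ncard = 0 ∧ S = cyc σ v := by
  rw [IsFixedII₂Plane, isFixedIIPlane_iff hσ hσφ, not_exists_iff_ncard]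
  constructor
  · rintro ⟨⟨v, hv, h2, rfl⟩, h⟩
    rw [ncard_fixedILines_cyc hσ hσφ hv hn hqn hq] at h
    exact ⟨v, hv, h2, h, rfl⟩
  · rintro ⟨v, hv, h2, h, rfl⟩
    rw [ncard_fixedILines_cyc hσ hσφ hv hn hqn hq]
    exact ⟨⟨v, hv, h2, rfl⟩, h⟩

/-- The numbers of points and lines of each kind in a fixed plane. -/
lemma numIn_cyc (hσφ : Induces σ φ) {n : ℤ}
    (hn : n = -1 ∨ n = 0 ∨ n = 1) (hqn : (Nat.card F : ℤ) ≡ n [ZMOD 3]) (hq : 2 < Nat.card F)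
    {v : V} (hv : IsRegularVec σ v) (h2 : rk K (cyc σ v) = 2) {k g : ℕ}
    (hk : (eigenvaluesOfRk K σ v 1).ncard = k) (hg : {t : F | t ^ 3 = 1}.ncard = g) :
    numIn (cyc σ v) (IsFixedPoint σ) = g ∧
    numIn (cyc σ v) (IsICollinearPoint φ σ) = k * (Nat.card F - n) ∧
    numIn (cyc σ v) (IsIICollinearPoint φ σ) = (g - k) * (Nat.card F - n) ∧
    numIn (cyc σ v) (IsIITrianglePoint φ σ) =
      Nat.card F ^ 2 + Nat.card F + 1 - g * (Nat.card F - n + 1) ∧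
    numIn (cyc σ v) (IsFixedILine φ σ) = k ∧
    numIn (cyc σ v) (IsFixedIILine φ σ) = g - k := by
  have hk2 : ((eigenvaluesOfRk K σ v 2).ncard : ℤ) = g - k := by
    have := ncard_eigenvalues_add hσ hv h2
    omega
  refine ⟨?_, ?_, ?_, ?_, ?_, ?_⟩ <;> unfold numIn
  · rw [ncard_fixedPoints_cyc hσ hv, hg]
  · simp only [isICollinearPoint_iff hσφ]
    rw [collinearPoints_cyc_eq hσ hv, ncard_orbitSpan_mem hσ hv hn hqn _ (fun t ht => ht.1), hk]
  · simp only [isIICollinearPoint_iff hσφ]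
    rw [collinearPoints_cyc_eq hσ hv, ncard_orbitSpan_mem hσ hv hn hqn _ (fun t ht => ht.1), hk2]
  · rw [trianglePoints_cyc_eq hσ hσφ hv h2, ncard_orbitSpan_finrank_three hσ hv hn hqn, hg]
  · rw [ncard_fixedILines_cyc hσ hσφ hv hn hqn hq, hk]
  · rw [ncard_fixedIILines_cyc hσ hσφ hv hn hqn hq, hk2]

end Types

/-! ### Two-dimensional subspaces through a given subspace, by duality -/

section Duality
variable {F E : Type*} [Field F] [AddCommGroup E] [Module F E] [FiniteDimensional F E]

lemma ncard_hyperplanes_through [Finite F] (hE : finrank F E = 3) (M : Submodule F E) {m : ℕ}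
    (hM : finrank F M + m = 3) :
    {L : Submodule F E | M ≤ L ∧ finrank F L = 2}.ncard =
      ∑ i ∈ Finset.range m, Nat.card F ^ i := by
  have hM' : finrank F M.dualAnnihilator = m := by
    have := Subspace.finrank_add_finrank_dualAnnihilator_eq M
    omega
  rw [← ncard_points _ hM']
  have hinj : Function.Injective (dualAnnihilator : Submodule F E → _) := fun A B h =>
    (Subspace.dualAnnihilator_inj).1 h
  rw [← Set.ncard_image_of_injective _ hinj]
  congr 1
  ext A
  constructor
  · rintro ⟨L, ⟨hML, hL⟩, rfl⟩
    have := Subspace.finrank_add_finrank_dualAnnihilator_eq L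
    exact ⟨dualAnnihilator_anti hML, by omega⟩
  · rintro ⟨hAM, hA⟩
    refine ⟨A.dualCoannihilator, ⟨?_, ?_⟩, Subspace.dualCoannihilator_dualAnnihilator_eq⟩
    · rw [← Subspace.dualAnnihilator_le_dualAnnihilator_iff,
        Subspace.dualCoannihilator_dualAnnihilator_eq]
      exact hAM
    · have := Subspace.finrank_add_finrank_dualAnnihilator_eq A.dualCoannihilator
      rw [Subspace.dualCoannihilator_dualAnnihilator_eq] at this
      omega

end Duality

/-! ### Non-invariant two-dimensional subspaces of a cyclic module -/

section CyclicPlanes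
variable {F E : Type*} [Field F] [AddCommGroup E] [Module F E] [Finite F] [Finite E]
  {s : E ≃ₗ[F] E} (hs : ∀ x, s (s (s x)) = x) {w : E} (hw : IsRegularVec s w)
  (hE : finrank F E = 3)

lemma IsRegularVec.cyc_eq_top {w : E} (hw : IsRegularVec s w)
    (hE : finrank F E = 3) : cyc s w = ⊤ := eq_top_of_finrank_eq (hw.trans hE.symm)

include hs hw hE

lemma invariantPlanes_eq (M : Submodule F E) :
    {L : Submodule F E | M ≤ L ∧ finrank F L = 2 ∧ ∀ y ∈ L, s y ∈ L} =
      eigenplane s w '' {t : F | t ^ 3 = 1 ∧ M ≤ eigenplane s w t} := by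
  ext L
  constructor
  · rintro ⟨hM, h2, hinv⟩
    obtain ⟨t, ht, rfl⟩ := hw.eq_eigenplane hs (hw.cyc_eq_top hE ▸ le_top) hinv h2
    exact ⟨t, ⟨ht, hM⟩, rfl⟩
  · rintro ⟨t, ⟨ht, hM⟩, rfl⟩
    exact ⟨hM, hw.finrank_eigenplane hs ht, fun _ => apply_mem_eigenplane hs⟩

lemma ncard_invariantPlanes (M : Submodule F E) :
    {L : Submodule F E | M ≤ L ∧ finrank F L = 2 ∧ ∀ y ∈ L, s y ∈ L}.ncard =
      {t : F | t ^ 3 = 1 ∧ M ≤ eigenplane s w t}.ncard := by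
  rw [invariantPlanes_eq hs hw hE]
  exact Set.InjOn.ncard_image fun t ht t' _ h => hw.eigenplane_injOn hs ht.1 h

lemma ncard_noninvariantPlanes (M : Submodule F E) :
    {L : Submodule F E | M ≤ L ∧ finrank F L = 2 ∧ ¬ ∀ y ∈ L, s y ∈ L}.ncard +
      {t : F | t ^ 3 = 1 ∧ M ≤ eigenplane s w t}.ncard =
      {L : Submodule F E | M ≤ L ∧ finrank F L = 2}.ncard := by
  rw [← ncard_invariantPlanes hs hw hE,
    ← Set.ncard_union_eq _ (Set.toFinite _) (Set.toFinite _)]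
  · congr 1
    ext L
    simp only [Set.mem_union, Set.mem_ofPred_eq]
    tauto
  · rw [Set.disjoint_left]
    rintro L h h'
    exact h.2.2 h'.2.2

lemma ncard_noninvariantPlanes_total :
    ({L : Submodule F E | finrank F L = 2 ∧ ¬ ∀ y ∈ L, s y ∈ L}.ncard : ℤ) =
      Nat.card F ^ 2 + Nat.card F + 1 - {t : F | t ^ 3 = 1}.ncard := by
  have h := ncard_noninvariantPlanes hs hw hE ⊥
  rw [ncard_hyperplanes_through hE ⊥ (m := 3) (by rw [finrank_bot])] at h
  simp only [bot_le, true_and, and_true, Finset.sum_range_succ, Finset.sum_range_zero, zero_add,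
    pow_zero, pow_one] at h
  have h4 := congrArg (Nat.cast : ℕ → ℤ) h
  simp only [Nat.cast_add, Nat.cast_one, Nat.cast_pow] at h4
  linarith

/-- Among the q + 1 lines through the point, the invariant ones belong to the n + 1 roots t' of t'²
+ tt' + t², an expression symmetric in t and t'. -/
lemma ncard_noninvariantPlanes_through_eigenvec {n : ℤ}
    (hn : n = -1 ∨ n = 0 ∨ n = 1) (hqn : (Nat.card F : ℤ) ≡ n [ZMOD 3]) {t : F} (ht : t ^ 3 = 1) :
    ({L : Submodule F E | eigenvec s w t ∈ L ∧ finrank F L = 2 ∧ ¬ ∀ y ∈ L, s y ∈ L}.ncard : ℤ) =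
      Nat.card F - n := by
  have h := ncard_noninvariantPlanes hs hw hE (span F {eigenvec s w t})
  have h1 := finrank_span_singleton (K := F) (hw.eigenvec_ne_zero t)
  rw [ncard_hyperplanes_through hE _ (m := 2) (by rw [h1])] at h
  have hset : {t' : F | t' ^ 3 = 1 ∧ eigenvec s w t ∈ eigenplane s w t'} =
      {t' : F | t' ^ 2 + t * t' + t ^ 2 = 0} := by
    ext t'
    simp only [Set.mem_ofPred_eq]
    constructor
    · rintro ⟨ht', h⟩
      rw [eigenvec_mem_eigenplane hs hw ht'] at h
      linear_combination h
    · intro h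
      have ht' : t' ^ 3 = 1 := by linear_combination (t' - t) * h + ht
      refine ⟨ht', ?_⟩
      rw [eigenvec_mem_eigenplane hs hw ht']
      linear_combination h
  simp only [span_singleton_le_iff_mem, hset] at h
  have h3 := ncard_quadraticRoots ht hn hqn
  simp only [Finset.sum_range_succ, Finset.sum_range_zero, zero_add,
    pow_zero, pow_one] at h
  have h4 := congrArg (Nat.cast : ℕ → ℤ) h
  simp only [Nat.cast_add, Nat.cast_one] at h4
  linarith

-- Two eigenvectors with different eigenvalues would span `L` and make it invariant.
omit [Finite F] hE in
lemma eigenvec_unique {L : Submodule F E} (h2 : finrank F L = 2) (hL : ¬ ∀ y ∈ L, s y ∈ L)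
    {t t' : F} (ht : t ^ 3 = 1) (ht' : t' ^ 3 = 1) (hm : eigenvec s w t ∈ L)
    (hm' : eigenvec s w t' ∈ L) : t = t' := by
  by_contra hne
  apply hL
  have hle : span F {eigenvec s w t} ⊔ span F {eigenvec s w t'} ≤ L :=
    sup_le ((span_singleton_le_iff_mem _ _).2 hm) ((span_singleton_le_iff_mem _ _).2 hm')
  have h1 := finrank_span_singleton (K := F) (hw.eigenvec_ne_zero t)
  have h1' := finrank_span_singleton (K := F) (hw.eigenvec_ne_zero t')
  have hlt : span F {eigenvec s w t} < span F {eigenvec s w t} ⊔ span F {eigenvec s w t'} := by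
    rw [left_lt_sup]
    intro h
    exact hne (hw.span_eigenvec_injective
      (eq_of_le_of_finrank_eq h (h1'.trans h1.symm))).symm
  have := finrank_lt_finrank_of_lt hlt
  rw [← eq_of_le_of_finrank_le hle (by omega)]
  intro y hy
  obtain ⟨a, ha, b, hb, rfl⟩ := mem_sup.1 hy
  obtain ⟨c, rfl⟩ := mem_span_singleton.1 ha
  obtain ⟨d, rfl⟩ := mem_span_singleton.1 hb
  rw [map_add, map_smul, map_smul, apply_eigenvec hs w ht, apply_eigenvec hs w ht']
  exact add_mem (mem_sup_left (smul_mem _ _ (smul_mem _ _ (mem_span_singleton_self _))))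
    (mem_sup_right (smul_mem _ _ (smul_mem _ _ (mem_span_singleton_self _))))

lemma exists_eigen_iff (L : Submodule F E) :
    (∃ x ∈ L, x ≠ 0 ∧ ∃ t : F, s x = t • x) ↔ ∃ t : F, t ^ 3 = 1 ∧ eigenvec s w t ∈ L := by
  constructor
  · rintro ⟨x, hx, hx0, t, ht⟩
    have ht3 := eigenvalue_pow_three hs hx0 ht
    obtain ⟨c, rfl⟩ := hw.eq_smul_eigenvec hs (hw.cyc_eq_top hE ▸ mem_top) ht
    have hc : c ≠ 0 := by
      rintro rfl
      simp at hx0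
    exact ⟨t, ht3, (smul_mem_iff _ hc).1 hx⟩
  · rintro ⟨t, ht, hm⟩
    exact ⟨_, hm, hw.eigenvec_ne_zero t, t, apply_eigenvec hs w ht⟩

lemma ncard_noninvariantPlanes_eigen {n : ℤ}
    (hn : n = -1 ∨ n = 0 ∨ n = 1) (hqn : (Nat.card F : ℤ) ≡ n [ZMOD 3]) :
    ({L : Submodule F E | finrank F L = 2 ∧ (¬ ∀ y ∈ L, s y ∈ L) ∧
      ∃ x ∈ L, x ≠ 0 ∧ ∃ t : F, s x = t • x}.ncard : ℤ) =
      {t : F | t ^ 3 = 1}.ncard * (Nat.card F - n) := by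
  simp only [exists_eigen_iff hs hw hE]
  have h1 : (1 : F) ^ 3 = 1 := one_pow 3
  rw [← ncard_noninvariantPlanes_through_eigenvec hs hw hE hn hqn h1, ← Nat.cast_mul, Nat.cast_inj]
  -- The eigenvalue occurring in `L` is unique, so choosing it defines the map whose fibres are
  -- counted.
  have hf (L : Submodule F E) (h : ∃ t : F, t ^ 3 = 1 ∧ eigenvec s w t ∈ L) :=
    Classical.epsilon_spec h
  apply ncard_eq_ncard_mul_of_fibers (Set.toFinite _)
    (f := fun L => Classical.epsilon fun t : F => t ^ 3 = 1 ∧ eigenvec s w t ∈ L) _ (Set.toFinite _)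
  · intro t ht
    rw [← Nat.cast_inj (R := ℤ), ncard_noninvariantPlanes_through_eigenvec hs hw hE hn hqn h1,
      ← ncard_noninvariantPlanes_through_eigenvec hs hw hE hn hqn ht]
    congr 2
    ext L
    constructor
    · rintro ⟨⟨h2, hL, hex⟩, rfl⟩
      exact ⟨(hf L hex).2, h2, hL⟩
    · rintro ⟨hm, h2, hL⟩
      have hex : ∃ t : F, t ^ 3 = 1 ∧ eigenvec s w t ∈ L := ⟨t, ht, hm⟩
      exact ⟨⟨h2, hL, hex⟩, eigenvec_unique hs hw h2 hL (hf L hex).1 ht (hf L hex).2 hm⟩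
  · rintro L ⟨-, -, h⟩
    exact (hf L h).1

end CyclicPlanes

/-! ### From vectors of V to subspaces of K spanned by their coordinates -/

section Vectors
variable {F K V : Type*} [Field F] [Field K] [AddCommGroup V] [Module K V] [Module F V]
  [Algebra F K] {τ : K ≃ₐ[F] K}

/-- The normal basis theorem; it makes the results on cyclic modules applicable to `K` with τ. -/
lemma exists_isRegularVec [Finite K] (hτ3 : ∀ a, τ (τ (τ a)) = a) (hτ : ∃ a, τ a ≠ a) :
    ∃ w : K, IsRegularVec τ.toLinearEquiv w := by
  obtain ⟨w, hw⟩ := exists_linearIndependent_algEquiv_apply F K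
  obtain ⟨a, ha⟩ := hτ
  have h01 : (1 : K ≃ₐ[F] K) ≠ τ := fun h => ha (DFunLike.congr_fun h a).symm
  have h02 : (1 : K ≃ₐ[F] K) ≠ τ * τ := fun h => by
    have h2 : a = τ (τ a) := DFunLike.congr_fun h a
    apply ha
    conv_rhs => rw [← hτ3 a]
    rw [← h2]
  have h12 : τ ≠ τ * τ := fun h => h01 (mul_eq_left.1 h.symm).symm
  have hinj : Function.Injective (![1, τ, τ * τ] : Fin 3 → (K ≃ₐ[F] K)) := by
    intro i j h
    fin_cases i <;> fin_cases j <;> first | rfl | skip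
    exacts [absurd h h01, absurd h h02, absurd h.symm h01, absurd h h12, absurd h.symm h02,
      absurd h.symm h12]
  refine ⟨w, isRegularVec_iff.2 ?_⟩
  have h := hw.comp _ hinj
  have heq : ![w, τ.toLinearEquiv w, τ.toLinearEquiv (τ.toLinearEquiv w)] =
      (fun ρ : K ≃ₐ[F] K => ρ w) ∘ ![1, τ, τ * τ] := by
    ext i
    fin_cases i <;> rfl
  rw [heq]
  exact h

variable [IsScalarTower F K V] {b : Basis (Fin 3) K V}

/-- With `L` identified with F², the coordinates of v are the columns of a 2 × 3 matrix; they span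
F² iff the two rows are independent. -/
lemma coordSpan_fiber_eq {L : Submodule F K} (e : (Fin 2 → F) ≃ₗ[F] L) :
    {v : V | coordSpan F b v = L} =
      (fun z : Fin 2 → Fin 3 → F => b.equivFun.symm fun j => (e (flip z j) : K)) ''
        {z | LinearIndependent F z} := by
  let l : (Fin 2 → F) →ₗ[F] K := L.subtype ∘ₗ e.toLinearMap
  have hl : Function.Injective l := L.injective_subtype.comp e.injective
  have hrange : map l ⊤ = L := by
    rw [Submodule.map_comp, Submodule.map_top, LinearEquiv.range, Submodule.map_top, range_subtype]
  have key (z : Fin 2 → Fin 3 → F) :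
      coordSpan F b (b.equivFun.symm fun j => (e (flip z j) : K)) = L ↔ LinearIndependent F z := by
    have : coordSpan F b (b.equivFun.symm fun j => (e (flip z j) : K)) =
        map l (span F (Set.range (flip z))) := by
      rw [map_span, ← Set.range_comp, coordSpan]
      congr 2
      ext j
      rw [← Basis.equivFun_apply, LinearEquiv.apply_symm_apply]
      rfl
    rw [← span_flip_eq_top_iff_linearIndependent, this]
    conv_lhs => rhs; rw [← hrange]
    exact (map_injective_of_injective hl).eq_iff
  ext v
  constructor
  · intro hv
    have hmem (j : Fin 3) : b.repr v j ∈ L := hv ▸ subset_span ⟨j, rfl⟩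
    let z : Fin 2 → Fin 3 → F := fun i j => e.symm ⟨b.repr v j, hmem j⟩ i
    have hz : (b.equivFun.symm fun j => (e (flip z j) : K)) = v := by
      rw [LinearEquiv.symm_apply_eq]
      ext j
      have : flip z j = e.symm ⟨b.repr v j, hmem j⟩ := rfl
      rw [this, e.apply_symm_apply, Basis.equivFun_apply]
    refine ⟨z, (key z).1 ?_, hz⟩
    rw [hz]
    exact hv
  · rintro ⟨z, hz, rfl⟩
    exact (key z).2 hz

lemma ncard_coordSpan_fiber [Finite F] {L : Submodule F K} (hL : finrank F L = 2) :
    {v : V | coordSpan F b v = L}.ncard =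
      (Nat.card F ^ 3 - 1) * (Nat.card F ^ 3 - Nat.card F) := by
  have : FiniteDimensional F L := FiniteDimensional.of_finrank_pos (by omega)
  let e : (Fin 2 → F) ≃ₗ[F] L :=
    LinearEquiv.ofFinrankEq _ _ (by rw [hL, finrank_fintype_fun_eq_card, Fintype.card_fin])
  have := Fintype.ofFinite F
  rw [coordSpan_fiber_eq e, Set.ncard_image_of_injective]
  · rw [← Nat.card_coe_set_eq]
    have h := card_linearIndependent (K := F) (V := Fin 3 → F) (k := 2)
      (by rw [finrank_fintype_fun_eq_card, Fintype.card_fin]; decide)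
    rw [finrank_fintype_fun_eq_card, Fintype.card_fin] at h
    refine h.trans ?_
    simp [Fin.prod_univ_two]
  · intro z z' h
    have h1 := b.equivFun.symm.injective h
    ext i j
    have h2 := e.injective (Subtype.ext (congrFun h1 j))
    exact congrFun h2 i

lemma ncard_coordSpan [Finite F] [Finite V] [Finite K] (p : Submodule F K → Prop)
    (hp : ∀ L, p L → finrank F L = 2) :
    {v : V | p (coordSpan F b v)}.ncard =
      {L : Submodule F K | p L}.ncard *
        ((Nat.card F ^ 3 - 1) * (Nat.card F ^ 3 - Nat.card F)) := by
  apply ncard_eq_ncard_mul_of_fibers (Set.toFinite _) (f := fun v => coordSpan F b v)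
  · exact fun v hv => hv
  · exact Set.toFinite _
  · intro L hL
    rw [← ncard_coordSpan_fiber (b := b) (hp L hL)]
    congr 1
    ext v
    exact ⟨fun h => h.2, fun h => ⟨by rw [Set.mem_ofPred_eq, show coordSpan F b v = L from h]; exact hL, h⟩⟩

variable {σ : V ≃ₗ[F] V} [Finite K] (hτ3 : ∀ a, τ (τ (τ a)) = a) (hτ : ∃ a, τ a ≠ a)
  (hK : finrank F K = 3) (hσ3 : ∀ x, σ (σ (σ x)) = x)
  (hb : ∀ i, σ (b i) = b i) (hσ : ∀ (a : K) (x : V), σ (a • x) = τ a • σ x)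

-- `σ` acts on coordinates by τ, so an `F`-relation on the orbit of v is an operator c₀ + c₁τ + c₂τ²
-- killing every coordinate.
include hb hσ in
lemma comb_eq_zero_iff {v : V} {c₀ c₁ c₂ : F} : c₀ • v + c₁ • σ v + c₂ • σ (σ v) = 0 ↔
    ∀ y ∈ coordSpan F b v, c₀ • y + c₁ • τ y + c₂ • τ (τ y) = 0 := by
  have hr := repr_apply hb hσ
  let f : K →ₗ[F] K := c₀ • LinearMap.id + c₁ • τ.toLinearMap +
    c₂ • (τ.toLinearMap ∘ₗ τ.toLinearMap)
  have hrepr (c : F) (x : V) (i : Fin 3) : b.repr (c • x) i = c • b.repr x i := by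
    rw [← algebraMap_smul K c x, map_smul, Finsupp.smul_apply, algebraMap_smul]
  have h1 : c₀ • v + c₁ • σ v + c₂ • σ (σ v) = 0 ↔ ∀ i, f (b.repr v i) = 0 := by
    rw [← b.repr.map_eq_zero_iff, Finsupp.ext_iff]
    refine forall_congr' fun i => ?_
    rw [map_add, map_add, Finsupp.add_apply, Finsupp.add_apply, hrepr, hrepr, hrepr, hr, hr, hr]
    rfl
  have h2 : (∀ y ∈ coordSpan F b v, c₀ • y + c₁ • τ y + c₂ • τ (τ y) = 0) ↔
      coordSpan F b v ≤ LinearMap.ker f := Iff.rfl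
  rw [h1, h2, coordSpan, span_le]
  exact ⟨fun h => by rintro _ ⟨i, rfl⟩; exact h i, fun h i => h ⟨i, rfl⟩⟩

-- An invariant L is the image of τ − t for a cube root of unity t, hence killed by τ² + tτ + t²,
-- which is a relation on the orbit. Conversely, a nontrivial relation is a nonzero operator on `K`
-- by the normal basis; its kernel contains L, so equals L by dimension, and is invariant because
-- the operator commutes with τ.
include hτ3 hτ hK hb hσ in
lemma isRegularVec_iff_coordSpan {v : V} (h2 : finrank F (coordSpan F b v) = 2) :
    IsRegularVec σ v ↔ ¬ ∀ y ∈ coordSpan F b v, τ y ∈ coordSpan F b v := by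
  obtain ⟨w, hw⟩ := exists_isRegularVec hτ3 hτ
  have hs : ∀ x, τ.toLinearEquiv (τ.toLinearEquiv (τ.toLinearEquiv x)) = x := hτ3
  have : Finite F := Finite.of_injective _ (algebraMap F K).injective
  constructor
  · intro hv hinv
    obtain ⟨t, ht, hL⟩ := hw.eq_eigenplane hs (hw.cyc_eq_top hK ▸ le_top) hinv h2
    have := (comb_eq_zero_iff hb hσ (v := v) (c₀ := t ^ 2) (c₁ := t) (c₂ := 1)).2 ?_
    · simpa using (hv.coord this).2.2
    · intro y hy
      rw [hL, eigenplane, mem_cyc] at hy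
      obtain ⟨a, b', c, rfl⟩ := hy
      simp only [AlgEquiv.toLinearEquiv_apply, map_add, map_sub, map_smul, hτ3]
      have hmod : ∀ x y z : K, t ^ 2 • (a • (y - t • x) + b' • (z - t • y) + c • (x - t • z)) +
        t • (a • (z - t • y) + b' • (x - t • z) + c • (y - t • x)) +
        (1 : F) • (a • (x - t • z) + b' • (y - t • x) + c • (z - t • y)) =
        (1 - t ^ 3) • (a • x + b' • y + c • z) := by
        intro x y z
        module
      rw [hmod, ht, sub_self, zero_smul]
  · intro hinv
    by_contra hv
    apply hinv
    have : ∃ c₀ c₁ c₂ : F, c₀ • v + c₁ • σ v + c₂ • σ (σ v) = 0 ∧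
        ¬ (c₀ = 0 ∧ c₁ = 0 ∧ c₂ = 0) := by
      by_contra! hall
      exact hv (isRegularVec_of_coord fun a b c h => hall a b c h)
    obtain ⟨c₀, c₁, c₂, hc, hne⟩ := this
    rw [comb_eq_zero_iff hb hσ] at hc
    let f : K →ₗ[F] K := c₀ • LinearMap.id + c₁ • τ.toLinearMap +
      c₂ • (τ.toLinearMap ∘ₗ τ.toLinearMap)
    have hf (y : K) : f y = c₀ • y + c₁ • τ y + c₂ • τ (τ y) := rfl
    have hle : coordSpan F b v ≤ LinearMap.ker f := hc
    have hlt : LinearMap.ker f < ⊤ := by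
      rw [lt_top_iff_ne_top]
      intro htop
      have hfw : f w = 0 := by
        rw [← LinearMap.mem_ker, htop]
        exact mem_top
      exact hne (hw.coord hfw)
    have h3 := finrank_lt hlt.ne
    rw [hK] at h3
    have heq := eq_of_le_of_finrank_le hle (by omega)
    rw [heq]
    intro y hy
    rw [LinearMap.mem_ker, hf] at hy ⊢
    have := congrArg τ hy
    simpa only [map_add, map_smul, map_zero] using this

variable [Finite F] [Finite V]

-- The generator σv − tv of the eigenplane has coordinate span (τ − t)L. As dim L = 2 and the rank
-- is 1 or 2, it is 1 iff τ − t has a kernel on L.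
include hτ3 hτ hK hσ3 hb hσ in
lemma rk_eigenplane_eq_one_iff {v : V} (hv : IsRegularVec σ v)
    (h2 : finrank F (coordSpan F b v) = 2) {t : F} (ht : t ^ 3 = 1) :
    rk K (eigenplane σ v t) = 1 ↔ ∃ x ∈ coordSpan F b v, x ≠ 0 ∧ τ x = t • x := by
  have hr := repr_apply hb hσ
  have hrk := rk_cyc hτ3 hτ hK hb hσ
  have hor := rk_eigenplane hσ3 hv ((hrk v).trans h2) ht
  let f : K →ₗ[F] K := τ.toLinearMap - t • LinearMap.id
  have hrepr (c : F) (x : V) (i : Fin 3) : b.repr (c • x) i = c • b.repr x i := by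
    rw [← algebraMap_smul K c x, map_smul, Finsupp.smul_apply, algebraMap_smul]
  have hmap : coordSpan F b (σ v - t • v) = map f (coordSpan F b v) := by
    rw [coordSpan, coordSpan, map_span, ← Set.range_comp]
    congr 2
    ext i
    rw [map_sub, Finsupp.sub_apply, hr, hrepr]
    rfl
  rw [eigenplane, hrk, hmap] at hor ⊢
  let g := f.domRestrict (coordSpan F b v)
  have hg : map f (coordSpan F b v) = LinearMap.range g := (LinearMap.range_domRestrict _ _).symm
  have hrn := g.finrank_range_add_finrank_ker
  rw [hg] at hor ⊢
  rw [h2] at hrn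
  have hker : finrank F (LinearMap.ker g) = 0 ↔ LinearMap.ker g = ⊥ := finrank_eq_zero
  have : (∃ x ∈ coordSpan F b v, x ≠ 0 ∧ τ x = t • x) ↔ LinearMap.ker g ≠ ⊥ := by
    rw [Submodule.ne_bot_iff]
    constructor
    · rintro ⟨x, hx, hx0, h⟩
      exact ⟨⟨x, hx⟩, sub_eq_zero.2 h, fun h0 => hx0 (congrArg Subtype.val h0)⟩
    · rintro ⟨⟨x, hx⟩, h, h0⟩
      exact ⟨x, hx, fun hx0 => h0 (Subtype.ext hx0), sub_eq_zero.1 h⟩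
  rw [this, Ne, ← hker]
  omega

include hτ3 hτ hK hσ3 hb hσ in
lemma eigenvaluesOfRk_one_nonempty_iff {v : V} (hv : IsRegularVec σ v)
    (h2 : finrank F (coordSpan F b v) = 2) :
    (eigenvaluesOfRk K σ v 1).Nonempty ↔
      ∃ x ∈ coordSpan F b v, x ≠ 0 ∧ ∃ t : F, τ x = t • x := by
  constructor
  · rintro ⟨t, ht, h⟩
    obtain ⟨x, hx, hx0, hxt⟩ := (rk_eigenplane_eq_one_iff hτ3 hτ hK hσ3 hb hσ hv h2 ht).1 h
    exact ⟨x, hx, hx0, t, hxt⟩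
  · rintro ⟨x, hx, hx0, t, hxt⟩
    have ht := eigenvalue_pow_three (s := τ.toLinearEquiv) hτ3 hx0 hxt
    exact ⟨t, ht, (rk_eigenplane_eq_one_iff hτ3 hτ hK hσ3 hb hσ hv h2 ht).2 ⟨x, hx, hx0, hxt⟩⟩

omit [Algebra F K] [Finite K] [IsScalarTower F K V] [Module K V] [Field K] in
include hσ3 in
/-- Counting cyclic planes through their generating vectors. -/
lemma ncard_regularVec {p : Submodule F V → Prop}
    (hp : ∀ S, p S → ∃ v, IsRegularVec σ v ∧ S = cyc σ v) {n : ℤ}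
    (hn : n = -1 ∨ n = 0 ∨ n = 1) (hqn : (Nat.card F : ℤ) ≡ n [ZMOD 3]) :
    ({v : V | IsRegularVec σ v ∧ p (cyc σ v)}.ncard : ℤ) = {S | p S}.ncard *
      ((Nat.card F ^ 2 + Nat.card F + 1 - {t : F | t ^ 3 = 1}.ncard * (Nat.card F - n + 1)) *
        (Nat.card F - 1)) := by
  -- The generators of a fixed cyclic plane are the q − 1 nonzero vectors on each of its points with
  -- triangle orbit.
  have hfib (v₀ : V) (hv₀ : IsRegularVec σ v₀) :
      ({v : V | IsRegularVec σ v ∧ cyc σ v = cyc σ v₀}.ncard : ℤ) =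
      (Nat.card F ^ 2 + Nat.card F + 1 - {t : F | t ^ 3 = 1}.ncard * (Nat.card F - n + 1)) *
        (Nat.card F - 1) := by
    have h1 := ncard_orbitSpan_finrank_three hσ3 hv₀ hn hqn
    have h2 := ncard_nonzero_eq (F := F) (E := V)
      (fun A => A ≤ cyc σ v₀ ∧ finrank F (orbitSpan σ A) = 3)
    have hset : {A : Submodule F V | finrank F A = 1 ∧ A ≤ cyc σ v₀ ∧
        finrank F (orbitSpan σ A) = 3} = {A : Submodule F V | A ≤ cyc σ v₀ ∧ finrank F A = 1 ∧
        finrank F (orbitSpan σ A) = 3} := by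
      ext A
      exact and_left_comm
    have hset2 : {v : V | IsRegularVec σ v ∧ cyc σ v = cyc σ v₀} =
        {x : V | x ≠ 0 ∧ span F {x} ≤ cyc σ v₀ ∧ finrank F (orbitSpan σ (span F {x})) = 3} := by
      ext x
      rw [Set.mem_ofPred_eq, Set.mem_ofPred_eq, orbitSpan_span_singleton, span_singleton_le_iff_mem]
      constructor
      · rintro ⟨hx, h⟩
        exact ⟨hx.ne_zero, h ▸ self_mem_cyc x, hx⟩
      · rintro ⟨-, hx, h3⟩
        exact ⟨h3, eq_of_le_of_finrank_eq (cyc_mono hσ3 hx) (h3.trans hv₀.symm)⟩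
    rw [hset2, h2, hset, Nat.cast_mul, h1, Nat.cast_sub Nat.card_pos, Nat.cast_one]
  rcases Set.eq_empty_or_nonempty {S | p S} with hemp | ⟨S₀, hS₀⟩
  · rw [hemp]
    have : {v : V | IsRegularVec σ v ∧ p (cyc σ v)} = ∅ := by
      rw [Set.eq_empty_iff_forall_notMem] at hemp ⊢
      exact fun v hv => hemp _ hv.2
    rw [this]
    simp
  · obtain ⟨v₀, hv₀, rfl⟩ := hp _ hS₀
    rw [← hfib v₀ hv₀, ← Nat.cast_mul, Nat.cast_inj]
    apply ncard_eq_ncard_mul_of_fibers (Set.toFinite _) (f := fun v => cyc σ v) (fun v hv => hv.2)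
      (Set.toFinite _)
    intro S hS
    obtain ⟨v, hv, rfl⟩ := hp S hS
    rw [← Nat.cast_inj (R := ℤ), hfib v₀ hv₀, ← hfib v hv]
    congr 2
    ext x
    exact ⟨fun h => ⟨h.1.1, h.2⟩, fun h => ⟨⟨h.1, by rw [h.2]; exact hS⟩, h.2⟩⟩

end Vectors

lemma card_cases {q : ℕ} (hq : 2 < q) {n : ℤ} (hn : n = -1 ∨ n = 0 ∨ n = 1)
    (hqn : (q : ℤ) ≡ n [ZMOD 3]) :
    (n = -1 ∧ Nat.gcd 3 (q - 1) = 1) ∨ (n = 0 ∧ Nat.gcd 3 (q - 1) = 1) ∨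
      (n = 1 ∧ Nat.gcd 3 (q - 1) = 3) := by
  unfold Int.ModEq at hqn
  rcases hn with rfl | rfl | rfl
  · exact Or.inl ⟨rfl, (Nat.Prime.coprime_iff_not_dvd Nat.prime_three).2 (by omega)⟩
  · exact Or.inr (Or.inl ⟨rfl, (Nat.Prime.coprime_iff_not_dvd Nat.prime_three).2 (by omega)⟩)
  · exact Or.inr (Or.inr ⟨rfl, Nat.gcd_eq_left (by omega)⟩)

/-! ### Double counting the fixed planes -/

section PlaneCounts
variable {F K V : Type*} [Field F] [Finite F] [Field K] [Algebra F K]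
  [AddCommGroup V] [Module K V] [Module F V] [IsScalarTower F K V] [Finite K] [Finite V]
  {φ : Submodule K V ≃o Submodule K V} {σ : V ≃ₗ[F] V} {τ : K ≃ₐ[F] K} {b : Basis (Fin 3) K V}
  (hτ3 : ∀ a, τ (τ (τ a)) = a) (hτ : ∃ a, τ a ≠ a)
  (hK : finrank F K = 3) (hσ3 : ∀ x, σ (σ (σ x)) = x)
  (hb : ∀ i, σ (b i) = b i) (hσ : ∀ (a : K) (x : V), σ (a • x) = τ a • σ x)
  (hσφ : Induces σ φ) {n : ℤ} (hn : n = -1 ∨ n = 0 ∨ n = 1)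
  (hqn : (Nat.card F : ℤ) ≡ n [ZMOD 3]) (hq : 2 < Nat.card F)
include hσ3 hσφ

omit [Finite K] in
lemma isFixedIIPlane_cyc_iff {v : V} (hv : IsRegularVec σ v) :
    IsFixedIIPlane φ σ (cyc σ v) ↔ rk K (cyc σ v) = 2 := by
  rw [isFixedIIPlane_iff hσ3 hσφ]
  constructor
  · rintro ⟨w, -, h2, h⟩
    rw [h, h2]
  · intro h2
    exact ⟨v, hv, h2, rfl⟩

include hτ3 hτ hK hb hσ hn hqn hq

lemma isFixedII₁Plane_cyc_iff (v : V) :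
    IsRegularVec σ v ∧ IsFixedII₁Plane φ σ (cyc σ v) ↔
      finrank F (coordSpan F b v) = 2 ∧ (¬ ∀ y ∈ coordSpan F b v, τ y ∈ coordSpan F b v) ∧
        ∃ x ∈ coordSpan F b v, x ≠ 0 ∧ ∃ t : F, τ x = t • x := by
  rw [← rk_cyc hτ3 hτ hK hb hσ]
  by_cases hv : IsRegularVec σ v
  · rw [IsFixedII₁Plane, isFixedIIPlane_cyc_iff hσ3 hσφ hv, existsUnique_iff_ncard,
      ncard_fixedILines_cyc hσ3 hσφ hv hn hqn hq, and_iff_right hv]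
    refine and_congr_right fun h2 => ?_
    have h2' := h2
    rw [rk_cyc hτ3 hτ hK hb hσ] at h2'
    rw [and_iff_right ((isRegularVec_iff_coordSpan hτ3 hτ hK hb hσ h2').1 hv),
      ← eigenvaluesOfRk_one_nonempty_iff hτ3 hτ hK hσ3 hb hσ hv h2', Set.ncard_eq_one]
    constructor
    · rintro ⟨t, h⟩
      exact h ▸ Set.singleton_nonempty t
    · intro h
      exact Set.exists_eq_singleton_iff_nonempty_subsingleton.2
        ⟨h, eigenvaluesOfRk_one_subsingleton hσ3 hv h2⟩
  · refine iff_of_false (fun h => hv h.1) ?_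
    rintro ⟨h2, h, -⟩
    rw [rk_cyc hτ3 hτ hK hb hσ] at h2
    exact hv ((isRegularVec_iff_coordSpan hτ3 hτ hK hb hσ h2).2 h)

lemma isFixedII₂Plane_cyc_iff (v : V) :
    IsRegularVec σ v ∧ IsFixedII₂Plane φ σ (cyc σ v) ↔
      finrank F (coordSpan F b v) = 2 ∧ (¬ ∀ y ∈ coordSpan F b v, τ y ∈ coordSpan F b v) ∧
        ¬ ∃ x ∈ coordSpan F b v, x ≠ 0 ∧ ∃ t : F, τ x = t • x := by
  rw [← rk_cyc hτ3 hτ hK hb hσ]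
  by_cases hv : IsRegularVec σ v
  · rw [IsFixedII₂Plane, isFixedIIPlane_cyc_iff hσ3 hσφ hv, not_exists_iff_ncard,
      ncard_fixedILines_cyc hσ3 hσφ hv hn hqn hq, and_iff_right hv]
    refine and_congr_right fun h2 => ?_
    have h2' := h2
    rw [rk_cyc hτ3 hτ hK hb hσ] at h2'
    rw [and_iff_right ((isRegularVec_iff_coordSpan hτ3 hτ hK hb hσ h2').1 hv),
      ← eigenvaluesOfRk_one_nonempty_iff hτ3 hτ hK hσ3 hb hσ hv h2', Set.not_nonempty_iff_eq_empty,
      Set.ncard_eq_zero (Set.toFinite _)]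
  · refine iff_of_false (fun h => hv h.1) ?_
    rintro ⟨h2, h, -⟩
    rw [rk_cyc hτ3 hτ hK hb hσ] at h2
    exact hv ((isRegularVec_iff_coordSpan hτ3 hτ hK hb hσ h2).2 h)

/-- Counting fixed planes through the coordinate spans of their generating vectors. -/
lemma ncard_fixedII₁Planes_mul :
    (Set.ncard {S : Submodule F V | IsFixedII₁Plane φ σ S} : ℤ) *
      ((Nat.card F ^ 2 + Nat.card F + 1 - {t : F | t ^ 3 = 1}.ncard * (Nat.card F - n + 1)) *
        (Nat.card F - 1)) =
      {t : F | t ^ 3 = 1}.ncard * (Nat.card F - n) *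
        ((Nat.card F ^ 3 - 1) * (Nat.card F ^ 3 - Nat.card F)) := by
  obtain ⟨w, hw⟩ := exists_isRegularVec hτ3 hτ
  have hq1 : 1 ≤ Nat.card F ^ 3 := Nat.one_le_pow _ _ (by omega)
  have hq3 : Nat.card F ≤ Nat.card F ^ 3 := Nat.le_self_pow (by decide) _
  -- Both sides count the vectors generating a fixed-II₁-plane: by the plane on the left, by the
  -- coordinate span on the right.
  rw [← ncard_noninvariantPlanes_eigen (s := τ.toLinearEquiv) hτ3 hw hK hn hqn,
    ← ncard_regularVec hσ3 (p := IsFixedII₁Plane φ σ) _ hn hqn]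
  · simp only [isFixedII₁Plane_cyc_iff hτ3 hτ hK hσ3 hb hσ hσφ hn hqn hq]
    have := ncard_coordSpan (V := V) (b := b) (fun L : Submodule F K => finrank F L = 2 ∧
      (¬ ∀ y ∈ L, τ y ∈ L) ∧ ∃ x ∈ L, x ≠ 0 ∧ ∃ t : F, τ x = t • x) (fun L h => h.1)
    rw [this, Nat.cast_mul, Nat.cast_mul, Nat.cast_sub hq1, Nat.cast_sub hq3]
    push_cast
    rfl
  · rintro S ⟨h, -⟩
    obtain ⟨v, hv, -, h⟩ := (isFixedIIPlane_iff hσ3 hσφ).1 h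
    exact ⟨v, hv, h⟩

lemma ncard_fixedII₂Planes_mul :
    (Set.ncard {S : Submodule F V | IsFixedII₂Plane φ σ S} : ℤ) *
      ((Nat.card F ^ 2 + Nat.card F + 1 - {t : F | t ^ 3 = 1}.ncard * (Nat.card F - n + 1)) *
        (Nat.card F - 1)) =
      (Nat.card F ^ 2 + Nat.card F + 1 - {t : F | t ^ 3 = 1}.ncard * (Nat.card F - n + 1)) *
        ((Nat.card F ^ 3 - 1) * (Nat.card F ^ 3 - Nat.card F)) := by
  obtain ⟨w, hw⟩ := exists_isRegularVec hτ3 hτ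
  have hq1 : 1 ≤ Nat.card F ^ 3 := Nat.one_le_pow _ _ (by omega)
  have hq3 : Nat.card F ≤ Nat.card F ^ 3 := Nat.le_self_pow (by decide) _
  have h1 := ncard_noninvariantPlanes_eigen (s := τ.toLinearEquiv) hτ3 hw hK hn hqn
  have h2 := ncard_noninvariantPlanes_total (s := τ.toLinearEquiv) hτ3 hw hK
  have h3 : {L : Submodule F K | finrank F L = 2 ∧ ¬ ∀ y ∈ L, τ y ∈ L}.ncard =
      {L : Submodule F K | finrank F L = 2 ∧
        (¬ ∀ y ∈ L, τ y ∈ L) ∧ ∃ x ∈ L, x ≠ 0 ∧ ∃ t : F, τ x = t • x}.ncard +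
      {L : Submodule F K | finrank F L = 2 ∧
        (¬ ∀ y ∈ L, τ y ∈ L) ∧ ¬ ∃ x ∈ L, x ≠ 0 ∧ ∃ t : F, τ x = t • x}.ncard := by
    rw [← Set.ncard_union_eq _ (Set.toFinite _) (Set.toFinite _)]
    · congr 1
      ext L
      rw [Set.mem_union, Set.mem_ofPred_eq, Set.mem_ofPred_eq, Set.mem_ofPred_eq, ← and_or_left,
        ← and_or_left, eq_true (em _), and_true]
    · rw [Set.disjoint_left]
      exact fun L h h' => h'.2.2 h.2.2
  -- Non-invariant L number q² + q + 1 − g, of which g(q − n) contain an eigenvector.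
  have h4 : ({L : Submodule F K | finrank F L = 2 ∧
        (¬ ∀ y ∈ L, τ y ∈ L) ∧ ¬ ∃ x ∈ L, x ≠ 0 ∧ ∃ t : F, τ x = t • x}.ncard : ℤ) =
      Nat.card F ^ 2 + Nat.card F + 1 - {t : F | t ^ 3 = 1}.ncard * (Nat.card F - n + 1) := by
    have h5 := congrArg (Nat.cast : ℕ → ℤ) h3
    rw [Nat.cast_add] at h5
    simp only [AlgEquiv.toLinearEquiv_apply] at h1 h2
    linarith
  rw [← ncard_regularVec hσ3 (p := IsFixedII₂Plane φ σ) _ hn hqn, ← h4]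
  · simp only [isFixedII₂Plane_cyc_iff hτ3 hτ hK hσ3 hb hσ hσφ hn hqn hq]
    have := ncard_coordSpan (V := V) (b := b) (fun L : Submodule F K => finrank F L = 2 ∧
      (¬ ∀ y ∈ L, τ y ∈ L) ∧ ¬ ∃ x ∈ L, x ≠ 0 ∧ ∃ t : F, τ x = t • x) (fun L h => h.1)
    rw [this, Nat.cast_mul, Nat.cast_mul, Nat.cast_sub hq1, Nat.cast_sub hq3]
    push_cast
    rfl
  · rintro S ⟨h, -⟩
    obtain ⟨v, hv, -, h⟩ := (isFixedIIPlane_iff hσ3 hσφ).1 h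
    exact ⟨v, hv, h⟩

lemma ncard_fixedPlanes {q g : ℕ} (hqc : Nat.card F = q) (hg : {t : F | t ^ 3 = 1}.ncard = g) :
    (Set.ncard {S : Submodule F V | IsFixedII₁Plane φ σ S} : ℤ) =
      g * (q - 2 + g - n) * (q + 1) * (q ^ 2 + q + 1) ∧
    (Set.ncard {S : Submodule F V | IsFixedII₂Plane φ σ S} : ℤ) =
      (q ^ 3 - q) * (q ^ 2 + q + 1) := by
  have h1 := ncard_fixedII₁Planes_mul hτ3 hτ hK hσ3 hb hσ hσφ hn hqn hq
  have h2 := ncard_fixedII₂Planes_mul hτ3 hτ hK hσ3 hb hσ hσφ hn hqn hq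
  have hc := card_cases hq hn hqn
  rw [← ncard_cubeRoots (F := F)] at hc
  rw [hg] at h1 h2 hc
  rw [hqc] at h1 h2
  generalize (Set.ncard {S : Submodule F V | IsFixedII₁Plane φ σ S} : ℤ) = x at *
  generalize (Set.ncard {S : Submodule F V | IsFixedII₂Plane φ σ S} : ℤ) = y at *
  have hq0 : (2 : ℤ) < q := by exact_mod_cast hqc ▸ hq
  have hq1 : ((q : ℤ) - 1) ≠ 0 := by omega
  have hq2 : ((q : ℤ) ^ 2 - 1) ≠ 0 := by nlinarith
  have hq3 : (q : ℤ) ≠ 0 := by omega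
  -- The number T of triangle points is q² − 1, q² or (q − 1)² for n = −1, 0, 1; in each case T(q −
  -- 1) is nonzero and cancels.
  rcases hc with ⟨rfl, rfl⟩ | ⟨rfl, rfl⟩ | ⟨rfl, rfl⟩ <;> push_cast at h1 h2 ⊢
  · have hne : ((q : ℤ) ^ 2 - 1) * (q - 1) ≠ 0 := mul_ne_zero hq2 hq1
    exact ⟨mul_right_cancel₀ hne (by linear_combination h1),
      mul_right_cancel₀ hne (by linear_combination h2)⟩
  · have hne : (q : ℤ) ^ 2 * (q - 1) ≠ 0 := mul_ne_zero (pow_ne_zero 2 hq3) hq1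
    exact ⟨mul_right_cancel₀ hne (by linear_combination h1),
      mul_right_cancel₀ hne (by linear_combination h2)⟩
  · have hne : ((q : ℤ) - 1) ^ 2 * (q - 1) ≠ 0 := mul_ne_zero (pow_ne_zero 2 hq1) hq1
    exact ⟨mul_right_cancel₀ hne (by linear_combination h1),
      mul_right_cancel₀ hne (by linear_combination h2)⟩

end PlaneCounts
end Figueroa

/-! ### The theorem -/

open Figueroa in
theorem theorem19 {F K V : Type*} [Field F] [Finite F] [Field K] [Algebra F K]
    [AddCommGroup V] [Module K V] [Module F V] [IsScalarTower F K V]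
    (hK : Module.finrank F K = 3) (hV : Module.finrank K V = 3)
    (q : ℕ) (hq : Nat.card F = q) (hq2 : 2 < q)
    (n : ℤ) (hn : n = -1 ∨ n = 0 ∨ n = 1) (hqn : (q : ℤ) ≡ n [ZMOD 3])
    (g : ℕ) (hg : g = Nat.gcd 3 (q - 1))
    (φ : Submodule K V ≃o Submodule K V) (hφ : Figueroa.IsPlanarOfOrderThree F φ)
    (σ : V ≃ₗ[F] V) (hσ : σ ^ 3 = 1) (hσφ : Figueroa.Induces σ φ) :
    -- the two types exhaust the fixed-II-planes, and they exclude each other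
    (∀ π : Submodule F V, Figueroa.IsFixedIIPlane φ σ π →
      Xor (Figueroa.IsFixedII₁Plane φ σ π) (Figueroa.IsFixedII₂Plane φ σ π)) ∧
    -- points and fixed lines in a fixed-II₁-plane
    (∀ π : Submodule F V, Figueroa.IsFixedII₁Plane φ σ π →
      Figueroa.numIn π (Figueroa.IsFixedPoint σ) = g ∧
      Figueroa.numIn π (Figueroa.IsICollinearPoint φ σ) = q - n ∧
      Figueroa.numIn π (Figueroa.IsIICollinearPoint φ σ) = (g - 1) * (q - n) ∧
      Figueroa.numIn π (Figueroa.IsIITrianglePoint φ σ) = q ^ 2 + q + 1 - g * (q - n + 1) ∧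
      Figueroa.numIn π (Figueroa.IsFixedILine φ σ) = 1 ∧
      Figueroa.numIn π (Figueroa.IsFixedIILine φ σ) = g - 1) ∧
    -- the number of fixed-II₁-planes
    ((Set.ncard {π : Submodule F V | Figueroa.IsFixedII₁Plane φ σ π} : ℤ) =
      g * (q - 2 + g - n) * (q + 1) * (q ^ 2 + q + 1)) ∧
    -- points and fixed lines in a fixed-II₂-plane
    (∀ π : Submodule F V, Figueroa.IsFixedII₂Plane φ σ π →
      Figueroa.numIn π (Figueroa.IsFixedPoint σ) = g ∧
      Figueroa.numIn π (Figueroa.IsICollinearPoint φ σ) = 0 ∧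
      Figueroa.numIn π (Figueroa.IsIICollinearPoint φ σ) = g * (q - n) ∧
      Figueroa.numIn π (Figueroa.IsIITrianglePoint φ σ) = q ^ 2 + q + 1 - g * (q - n + 1) ∧
      Figueroa.numIn π (Figueroa.IsFixedILine φ σ) = 0 ∧
      Figueroa.numIn π (Figueroa.IsFixedIILine φ σ) = g) ∧
    -- the number of fixed-II₂-planes
    ((Set.ncard {π : Submodule F V | Figueroa.IsFixedII₂Plane φ σ π} : ℤ) =
      (q ^ 3 - q) * (q ^ 2 + q + 1)) := by
  subst hq
  have : FiniteDimensional F K := Module.finite_of_finrank_pos (by omega)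
  have : FiniteDimensional K V := Module.finite_of_finrank_pos (by omega)
  have : Finite K := Module.finite_of_finite F
  have : Finite V := Module.finite_of_finite K
  have hσ3 (x : V) : σ (σ (σ x)) = x := LinearEquiv.congr_fun hσ x
  obtain ⟨τ, hτ3, hτσ⟩ := hσφ.exists_algEquiv hV hσ3
  have hτ := hσφ.exists_ne_of_isPlanar hφ hτσ
  obtain ⟨b, hb⟩ := exists_fixed_basis hτ3 hτ hV hσ3 hτσ
  have hg' : {t : F | t ^ 3 = 1}.ncard = g := by rw [ncard_cubeRoots, hg]
  obtain ⟨hcount₁, hcount₂⟩ :=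
    ncard_fixedPlanes hτ3 hτ hK hσ3 hb hτσ hσφ hn hqn hq2 rfl hg'
  refine ⟨?_, ?_, hcount₁, ?_, hcount₂⟩
  · intro S hS
    obtain ⟨v, hv, h2, rfl⟩ := (isFixedIIPlane_iff hσ3 hσφ).1 hS
    have hsub := eigenvaluesOfRk_one_subsingleton hσ3 hv h2
    have hle := (Set.ncard_le_one_iff_subsingleton).2 hsub
    rw [IsFixedII₁Plane, IsFixedII₂Plane, existsUnique_iff_ncard, not_exists_iff_ncard,
      ncard_fixedILines_cyc hσ3 hσφ hv hn hqn hq2, and_iff_right hS, and_iff_right hS]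
    rw [Xor]
    omega
  · intro S hS
    obtain ⟨v, hv, h2, hk, rfl⟩ := (isFixedII₁Plane_iff hσ3 hσφ hn hqn hq2).1 hS
    simpa using numIn_cyc hσ3 hσφ hn hqn hq2 hv h2 hk hg'
  · intro S hS
    obtain ⟨v, hv, h2, hk, rfl⟩ := (isFixedII₂Plane_iff hσ3 hσφ hn hqn hq2).1 hS
    simpa using numIn_cyc hσ3 hσφ hn hqn hq2 hv h2 hk hg'
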